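/- Let $X$ be a smooth projective variety over $\mathbb{C}$ and let $(E_1,\dots,E_k)$ be a simple collection of coherent sheaves on $X$, i.e. $\mathrm{Hom}(E_i,E_j)=\mathbb{C}\cdot\delta_{ij}$. Put $E_i^{(0)}=E_i$ and let $E_i^{(n+1)}$ be the universal extension $$0\to\bigoplus_{j=1}^k \mathrm{Ext}^1(E_i^{(n)},E_j)^{\vee}\otimes E_j\to E_i^{(n+1)}\to E_i^{(n)}\to 0,$$ that is, the extension whose class corresponds to the identities of the spaces $\mathrm{Ext}^1(E_i^{(n)},E_j)$; fix any choice of these iterated universal extensions. Let $E^{(n)}=\bigoplus_{i=1}^k E_i^{(n)}$ and $R^{(n)}=\mathrm{Hom}(E^{(n)},E^{(n)})$, and let $R^{nc}=\varprojlim R^{(n)}$, where the transition map $R^{(n+1)}\to R^{(n)}$ is induced by the projection $E^{(n+1)}\to E^{(n)}$. Let $\mathrm{mod}\,R^{(n)}$ be the category of finite-dimensional right $R^{(n)}$-modules, and let $\mathrm{mod}_{nil}R^{nc}=\varinjlim \mathrm{mod}\,R^{(n)}$, the category of finite-dimensional nilpotent right $R^{nc}$-modules, i.e. the full subcategory of right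 $R^{nc}$-modules that come from $\mathrm{mod}\,R^{(n)}$ for some $n$. Let $\langle E_1,\dots,E_k\rangle\subset \mathrm{Coh}(X)$ be the extension closure of $E_1,\dots,E_k$, i.e. the smallest full subcategory that contains $0$ and $E_1,\dots,E_k$ and is closed under extensions in $\mathrm{Coh}(X)$. Then the functors $T\mapsto T\otimes_{R^{(n)}}E^{(n)}$ on the categories $\mathrm{mod}\,R^{(n)}$ are compatible for varying $n$ (via $x\otimes e\mapsto x\otimes\pi(e)$ for the projection $\pi\colon E^{(n+1)}\to E^{(n)}$), they take values in $\langle E_1,\dots,E_k\rangle$, and the functor that they define, $$\Phi\colon \mathrm{mod}_{nil}R^{nc}\to\langle E_1,\dots,E_k\rangle,\qquad \Phi(T)=T\otimes_{R^{(n)}}E^{(n)}\ \text{ for } T\in \mathrm{mod}\,R^{(n)},$$ is an equivalence of categories. -/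

import Mathlib

open CategoryTheory CategoryTheory.Limits CategoryTheory.Abelian AlgebraicGeometry MulOpposite

noncomputable section

namespace NCHull

universe w v u

/-! ## Tensoring a right module over `End G` with the object `G` -/

section Tensor

variable {C : Type u} [Category.{v} C] [Abelian C]

/-- The morphism `g x : G ⟶ Y` for an `R`-linear map `g : T ⟶ Hom (G, Y)` and `x` in `T`. -/
def evalHom {G : C} {T : ModuleCat.{v} (End G)ᵐᵒᵖ} {Y : C}
    (g : T ⟶ (preadditiveCoyonedaObj G).obj Y) (x : T) : G ⟶ Y := g.hom x

theorem evalHom_add {G : C} {T : ModuleCat.{v} (End G)ᵐᵒᵖ} {Y : C}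
    (g : T ⟶ (preadditiveCoyonedaObj G).obj Y) (x y : T) :
    evalHom g (x + y) = evalHom g x + evalHom g y := g.hom.map_add x y

theorem evalHom_smul {G : C} {T : ModuleCat.{v} (End G)ᵐᵒᵖ} {Y : C}
    (g : T ⟶ (preadditiveCoyonedaObj G).obj Y) (x : T) (r : End G) :
    evalHom g (op r • x) = End.asHom r ≫ evalHom g x := g.hom.map_smul (op r) x

theorem hom_ext_evalHom {G : C} {T : ModuleCat.{v} (End G)ᵐᵒᵖ} {Y : C}
    {g h : T ⟶ (preadditiveCoyonedaObj G).obj Y} (w : ∀ x, evalHom g x = evalHom h x) : g = h :=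
  ModuleCat.hom_ext (LinearMap.ext w)

variable [HasCoproducts.{v} C]

/-- The relations `(x + y) ⊗ e = x ⊗ e + y ⊗ e` and `(x r) ⊗ e = x ⊗ (r e)` that define `T ⊗ G`,
where `T` is a right module over `R = End G`, that is, a module over `Rᵐᵒᵖ`, with
`x r = op r • x`. Here `Sigma.ι _ x : G ⟶ ∐ G` is `e ↦ x ⊗ e`. -/
def tensorRel (G : C) (T : ModuleCat.{v} (End G)ᵐᵒᵖ) :
    (∐ fun _ : (T × T) ⊕ (T × End G) => G) ⟶ ∐ fun _ : T => G :=
  Sigma.desc (fun s => match s with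
    | Sum.inl p => Sigma.ι (fun _ : T => G) (p.1 + p.2)
        - Sigma.ι (fun _ : T => G) p.1 - Sigma.ι (fun _ : T => G) p.2
    | Sum.inr p => Sigma.ι (fun _ : T => G) (op p.2 • p.1)
        - End.asHom p.2 ≫ Sigma.ι (fun _ : T => G) p.1)

theorem ι_tensorRel_inl (G : C) (T : ModuleCat.{v} (End G)ᵐᵒᵖ) (x y : T) :
    Sigma.ι (fun _ : (T × T) ⊕ (T × End G) => G) (Sum.inl (x, y)) ≫ tensorRel G T =
      Sigma.ι (fun _ : T => G) (x + y)
        - Sigma.ι (fun _ : T => G) x - Sigma.ι (fun _ : T => G) y :=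
  Sigma.ι_desc _ _

theorem ι_tensorRel_inr (G : C) (T : ModuleCat.{v} (End G)ᵐᵒᵖ) (x : T) (r : End G) :
    Sigma.ι (fun _ : (T × T) ⊕ (T × End G) => G) (Sum.inr (x, r)) ≫ tensorRel G T =
      Sigma.ι (fun _ : T => G) (op r • x) - End.asHom r ≫ Sigma.ι (fun _ : T => G) x :=
  Sigma.ι_desc _ _

/-- The object `T ⊗_R G` of `C`, for `R = End G` and a right `R`-module `T`. -/
def tensorObj (G : C) (T : ModuleCat.{v} (End G)ᵐᵒᵖ) : C := cokernel (tensorRel G T)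

/-- The morphism `G ⟶ T ⊗_R G`, `e ↦ x ⊗ e`, given by an element `x` of `T`. -/
def pureTensor (G : C) (T : ModuleCat.{v} (End G)ᵐᵒᵖ) (x : T) : G ⟶ tensorObj G T :=
  Sigma.ι (fun _ : T => G) x ≫ cokernel.π (tensorRel G T)

theorem pureTensor_add (G : C) (T : ModuleCat.{v} (End G)ᵐᵒᵖ) (x y : T) :
    pureTensor G T (x + y) = pureTensor G T x + pureTensor G T y := by
  have h := Sigma.ι (fun _ : (T × T) ⊕ (T × End G) => G) (Sum.inl (x, y)) ≫=
    cokernel.condition (tensorRel G T)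
  rw [← Category.assoc, ι_tensorRel_inl, comp_zero, Preadditive.sub_comp, Preadditive.sub_comp,
    sub_sub, sub_eq_zero] at h
  exact h

theorem pureTensor_smul (G : C) (T : ModuleCat.{v} (End G)ᵐᵒᵖ) (x : T) (r : (End G)ᵐᵒᵖ) :
    pureTensor G T (r • x) = End.asHom (unop r) ≫ pureTensor G T x := by
  have h := Sigma.ι (fun _ : (T × T) ⊕ (T × End G) => G) (Sum.inr (x, unop r)) ≫=
    cokernel.condition (tensorRel G T)
  rw [← Category.assoc, ι_tensorRel_inr, comp_zero, Preadditive.sub_comp, sub_eq_zero,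
    Category.assoc] at h
  exact h

/-- The morphism `∐ G ⟶ Y` induced by an `R`-linear map `g : T ⟶ Hom (G, Y)`. -/
def tensorDescAux (G : C) (T : ModuleCat.{v} (End G)ᵐᵒᵖ) (Y : C)
    (g : T ⟶ (preadditiveCoyonedaObj G).obj Y) : (∐ fun _ : T => G) ⟶ Y :=
  Sigma.desc (evalHom g)

theorem ι_tensorDescAux (G : C) (T : ModuleCat.{v} (End G)ᵐᵒᵖ) (Y : C)
    (g : T ⟶ (preadditiveCoyonedaObj G).obj Y) (x : T) :
    Sigma.ι (fun _ : T => G) x ≫ tensorDescAux G T Y g = evalHom g x :=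
  Sigma.ι_desc _ _

theorem tensorRel_tensorDescAux (G : C) (T : ModuleCat.{v} (End G)ᵐᵒᵖ) (Y : C)
    (g : T ⟶ (preadditiveCoyonedaObj G).obj Y) : tensorRel G T ≫ tensorDescAux G T Y g = 0 := by
  refine Sigma.hom_ext _ _ fun s => ?_
  rcases s with ⟨x, y⟩ | ⟨x, r⟩
  · rw [← Category.assoc, ι_tensorRel_inl, comp_zero, Preadditive.sub_comp, Preadditive.sub_comp,
      ι_tensorDescAux, ι_tensorDescAux, ι_tensorDescAux, sub_sub, sub_eq_zero, evalHom_add]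
  · rw [← Category.assoc, ι_tensorRel_inr, comp_zero, Preadditive.sub_comp, Category.assoc,
      ι_tensorDescAux, ι_tensorDescAux, sub_eq_zero, evalHom_smul]

/-- The `R`-linear map `T ⟶ Hom (G, Y)`, `x ↦ (e ↦ f (x ⊗ e))`, for `f : T ⊗_R G ⟶ Y`. -/
def tensorCurry (G : C) (T : ModuleCat.{v} (End G)ᵐᵒᵖ) (Y : C) (f : tensorObj G T ⟶ Y) :
    T ⟶ (preadditiveCoyonedaObj G).obj Y :=
  ModuleCat.ofHom
    { toFun := fun x => pureTensor G T x ≫ f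
      map_add' := fun x y => by rw [pureTensor_add, Preadditive.add_comp]
      map_smul' := fun r x => by
        rw [pureTensor_smul, Category.assoc]
        rfl }

theorem evalHom_tensorCurry (G : C) (T : ModuleCat.{v} (End G)ᵐᵒᵖ) (Y : C)
    (f : tensorObj G T ⟶ Y) (x : T) :
    evalHom (tensorCurry G T Y f) x = pureTensor G T x ≫ f := rfl

/-- The tensor-hom correspondence `Hom (T ⊗_R G, Y) ≃ Hom_R (T, Hom (G, Y))`. -/
def tensorHomEquiv (G : C) (T : ModuleCat.{v} (End G)ᵐᵒᵖ) (Y : C) :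
    (tensorObj G T ⟶ Y) ≃ (T ⟶ (preadditiveCoyonedaObj G).obj Y) where
  toFun f := tensorCurry G T Y f
  invFun g := cokernel.desc _ (tensorDescAux G T Y g) (tensorRel_tensorDescAux G T Y g)
  left_inv f := by
    apply (cancel_epi (cokernel.π (tensorRel G T))).1
    refine Sigma.hom_ext _ _ fun x => ?_
    rw [cokernel.π_desc, ι_tensorDescAux, evalHom_tensorCurry]
    exact Category.assoc _ _ _
  right_inv g := hom_ext_evalHom fun x => by
    have h := cokernel.π_desc (tensorRel G T) (tensorDescAux G T Y g)
      (tensorRel_tensorDescAux G T Y g)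
    exact ((Category.assoc _ _ _).trans (congrArg (fun f => Sigma.ι (fun _ : T => G) x ≫ f) h)).trans
      (ι_tensorDescAux G T Y g x)

/-- The functor `T ↦ T ⊗_R G` from right `R`-modules to `C`, where `R = End G`; on morphisms it is
`x ⊗ e ↦ f x ⊗ e`. -/
def tensorFunctor (G : C) : ModuleCat.{v} (End G)ᵐᵒᵖ ⥤ C :=
  Adjunction.leftAdjointOfEquiv (G := preadditiveCoyonedaObj G) (F_obj := tensorObj G)
    (tensorHomEquiv G) (by
      intro T Y Y' g h
      apply ModuleCat.hom_ext
      ext x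
      exact (Category.assoc _ _ _).symm)

/-- The tensor-hom adjunction `(- ⊗_R G) ⊣ Hom (G, -)`. -/
def tensorAdjunction (G : C) : tensorFunctor G ⊣ preadditiveCoyonedaObj G :=
  Adjunction.adjunctionOfEquivLeft _ _

theorem pureTensor_map (G : C) {T T' : ModuleCat.{v} (End G)ᵐᵒᵖ} (f : T ⟶ T') (x : T) :
    pureTensor G T x ≫ (tensorFunctor G).map f = pureTensor G T' (f.hom x) := by
  have h : tensorHomEquiv G T _ ((tensorFunctor G).map f) =
      f ≫ tensorHomEquiv G T' _ (𝟙 _) := Equiv.apply_symm_apply _ _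
  have h' := congrArg (fun a => a.hom x) h
  exact h'.trans (Category.comp_id _)

end Tensor

/-! ## Simple collections, universal extensions, extension closure -/

section Abelian

variable (K : Type*) [Field K] {C : Type u} [Category.{v} C] [Abelian C] [Linear K C]

/-- `Hom (E i, E j) = K · δ_ij`. -/
structure IsSimpleCollection {J : Type*} (E : J → C) : Prop where
  bijective_algebraMap (i : J) : Function.Bijective (algebraMap K (End (E i)))
  eq_zero {i j : J} (hij : i ≠ j) (f : E i ⟶ E j) : f = 0

/-- The full subcategory `⟨E⟩`: the smallest class of objects satisfying `A` that contains the zero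
objects and the `E i` and is closed under extensions with middle term satisfying `A`. Closure under
isomorphisms is the case of extensions by zero objects. -/
inductive extensionClosure (A : ObjectProperty C) {J : Type*} (E : J → C) : ObjectProperty C
  | zero (M : C) (hM : IsZero M) : extensionClosure A E M
  | of (i : J) : extensionClosure A E (E i)
  | extension (S : ShortComplex C) (hS : S.ShortExact) (hA : A S.X₂)
      (h₁ : extensionClosure A E S.X₁) (h₃ : extensionClosure A E S.X₃) :
      extensionClosure A E S.X₂

variable [HasExt.{w} C]

/-- `0 ⟶ ⨁ j, V j^∨ ⊗ E j ⟶ S.X₂ ⟶ S.X₃ ⟶ 0` with `V j = Ext¹ (S.X₃, E j)` is the universal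
extension of `S.X₃` by the `E j`. In terms of a basis `b j` of `V j` with `d j` elements, the kernel
`S.X₁` is the direct sum of `d j` copies of `E j` for all `j`, with projections `p j m`, and the
extension class corresponds to the identities of the `V j`, that is, its image under `p j m` is the
basis element `b j m`. -/
structure IsUniversalExtension {J : Type*} (E : J → C) (S : ShortComplex C) : Prop where
  shortExact : S.ShortExact
  exists_basis : ∃ (d : J → ℕ) (b : ∀ j, Module.Basis (Fin (d j)) K (Ext.{w} S.X₃ (E j) 1))
    (p : ∀ j, Fin (d j) → (S.X₁ ⟶ E j)),
    Nonempty (IsLimit (Fan.mk S.X₁ fun x : (j : J) × Fin (d j) => p x.1 x.2)) ∧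
    ∀ j m, shortExact.extClass.comp (Ext.mk₀ (p j m)) (add_zero 1) = b j m

/-- A choice of iterated universal extensions `E_i^(n)` of a finite collection of objects `E_i`:
`E_i^(0) = E_i`, and `E_i^(n+1)` is the universal extension of `E_i^(n)` by the `E_j`. -/
structure UniversalExtensionTower {k : ℕ} (E : Fin k → C) where
  /-- the object `E_i^(n)` -/
  obj : ℕ → Fin k → C
  /-- the kernel of `E_i^(n+1) ⟶ E_i^(n)` -/
  ker : ℕ → Fin k → C
  /-- the inclusion of the kernel -/
  ι (n : ℕ) (i : Fin k) : ker n i ⟶ obj (n + 1) i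
  /-- the projection `E_i^(n+1) ⟶ E_i^(n)` -/
  π (n : ℕ) (i : Fin k) : obj (n + 1) i ⟶ obj n i
  ι_π (n : ℕ) (i : Fin k) : ι n i ≫ π n i = 0
  /-- the identification `E_i^(0) = E_i` -/
  objZero (i : Fin k) : obj 0 i ≅ E i
  isUniversalExtension (n : ℕ) (i : Fin k) :
    IsUniversalExtension.{w} K E (ShortComplex.mk (ι n i) (π n i) (ι_π n i))

/-- The property of a module over a `K`-algebra of being finite dimensional over `K`. -/
def finDim (R : Type*) [Ring R] [Algebra K R] : ObjectProperty (ModuleCat.{v} R) :=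
  fun T => FiniteDimensional K ((ModuleCat.restrictScalars (algebraMap K R)).obj T)

namespace UniversalExtensionTower

attribute [local instance] Abelian.hasFiniteBiproducts

variable {K} {k : ℕ} {E : Fin k → C} (t : UniversalExtensionTower.{w} K E)

/-- `E^(n) = ⨁ i, E_i^(n)`. -/
def total (n : ℕ) : C := ⨁ t.obj n

/-- The projection `E^(n+1) ⟶ E^(n)`. -/
def totalπ (n : ℕ) : t.total (n + 1) ⟶ t.total n := biproduct.map (t.π n)

/-- `R^(n) = Hom (E^(n), E^(n))`, with composition `(a * b) e = a (b e)` as multiplication. -/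
abbrev R (n : ℕ) : Type v := End (t.total n)

/-- The inverse limit `R^nc` of the `R^(n)`: sequences of endomorphisms `φ n` of the `E^(n)` that
correspond to each other under the projections `E^(n+1) ⟶ E^(n)`. The transition map
`R^(n+1) ⟶ R^(n)` sends `φ` to the only `φ'` for which `φ` and `φ'` commute with the (epimorphic)
projection. -/
def hull : Subalgebra K ((n : ℕ) → t.R n) where
  carrier := {φ | ∀ n, End.asHom (φ (n + 1)) ≫ t.totalπ n = t.totalπ n ≫ End.asHom (φ n)}
  mul_mem' {a b} ha hb n := by
    change (End.asHom (b (n + 1)) ≫ End.asHom (a (n + 1))) ≫ t.totalπ n =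
      t.totalπ n ≫ (End.asHom (b n) ≫ End.asHom (a n))
    rw [Category.assoc, ha n, ← Category.assoc, hb n, Category.assoc]
  add_mem' {a b} ha hb n := by
    change (End.asHom (a (n + 1)) + End.asHom (b (n + 1))) ≫ t.totalπ n =
      t.totalπ n ≫ (End.asHom (a n) + End.asHom (b n))
    rw [Preadditive.add_comp, Preadditive.comp_add, ha n, hb n]
  algebraMap_mem' r n := by
    change (r • 𝟙 (t.total (n + 1))) ≫ t.totalπ n = t.totalπ n ≫ (r • 𝟙 (t.total n))
    rw [Linear.smul_comp, Linear.comp_smul, Category.id_comp, Category.comp_id]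

/-- The projection `R^nc ⟶ R^(n)`. -/
def hullProj (n : ℕ) : t.hull →ₐ[K] t.R n := (Pi.evalAlgHom K t.R n).comp t.hull.val

/-- A right `R^(n)`-module regarded as a right `R^nc`-module. -/
def restrict (n : ℕ) : ModuleCat.{v} (t.R n)ᵐᵒᵖ ⥤ ModuleCat.{v} (t.hull)ᵐᵒᵖ :=
  ModuleCat.restrictScalars (RingHom.op (t.hullProj n : t.hull →+* t.R n))

/-- The category `mod R^(n)` of finite dimensional right `R^(n)`-modules. -/
abbrev modR (n : ℕ) := (finDim.{v} K (t.R n)ᵐᵒᵖ).FullSubcategory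

/-- The finite dimensional nilpotent right `R^nc`-modules: the union of the categories
`mod R^(n)` inside the category of right `R^nc`-modules. -/
def isNilpotent : ObjectProperty (ModuleCat.{v} (t.hull)ᵐᵒᵖ) :=
  fun T => ∃ (n : ℕ) (T' : t.modR n), Nonempty ((t.restrict n).obj T'.obj ≅ T)

/-- The category `mod_nil R^nc`. -/
abbrev modNil := t.isNilpotent.FullSubcategory

/-- The embedding of `mod R^(n)` into `mod_nil R^nc`. -/
def toModNil (n : ℕ) : t.modR n ⥤ t.modNil :=
  ObjectProperty.lift _ (ObjectProperty.ι _ ⋙ t.restrict n) fun T => ⟨n, T, ⟨Iso.refl _⟩⟩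

variable [HasCoproducts.{v} C]

/-- The functor `Φ : mod_nil R^nc ⥤ ⟨E⟩` given by `Φ(T) = T ⊗_{R^(n)} E^(n)` for `T` in
`mod R^(n)`. The identifications for `n` and `n + 1` are compatible with the maps
`T' ⊗_{R^(n+1)} E^(n+1) ⟶ T ⊗_{R^(n)} E^(n)`, `x ⊗ e ↦ f x ⊗ π e`, where `f : T' ⟶ T` is
`R^nc`-linear and `π` is the projection `E^(n+1) ⟶ E^(n)` (for `T' = T` and `f = id` these are the
isomorphisms obtained from `R^(n) ⊗_{R^(n+1)} E^(n+1) = E^(n)`). These data determine `Φ` up to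
isomorphism. -/
structure Phi (A : ObjectProperty C) where
  /-- the functor -/
  functor : t.modNil ⥤ (extensionClosure A E).FullSubcategory
  /-- the isomorphisms `Φ(T) ≅ T ⊗_{R^(n)} E^(n)`, natural in `T` in `mod R^(n)` -/
  iso (n : ℕ) : t.toModNil n ⋙ functor ⋙ (extensionClosure A E).ι ≅
    (finDim.{v} K (t.R n)ᵐᵒᵖ).ι ⋙ tensorFunctor (t.total n)
  compatible (n : ℕ) (T' : t.modR (n + 1)) (T : t.modR n)
    (f : (t.toModNil (n + 1)).obj T' ⟶ (t.toModNil n).obj T) (x : T'.obj) :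
    pureTensor (t.total (n + 1)) T'.obj x ≫ (iso (n + 1)).inv.app T' ≫ (functor.map f).hom =
      t.totalπ n ≫ pureTensor (t.total n) T.obj (f.hom.hom x) ≫ (iso n).inv.app T

end UniversalExtensionTower

end Abelian

/-! ## Coherent sheaves on smooth projective varieties over `ℂ` -/

section Geometry

/-- `Spec ℂ`. -/
abbrev SpecC : Scheme.{0} := Spec (CommRingCat.of ℂ)

attribute [local instance] MvPolynomial.gradedAlgebra

/-- The projective space `ℙ^N` over `ℂ`. -/
def projectiveSpace (N : ℕ) : Scheme.{0} :=
  Proj (MvPolynomial.homogeneousSubmodule (Fin (N + 1)) ℂ)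

/-- The structure morphism of projective space. -/
def projectiveSpaceToSpecC (N : ℕ) : projectiveSpace N ⟶ SpecC :=
  Proj.toSpecZero (MvPolynomial.homogeneousSubmodule (Fin (N + 1)) ℂ) ≫
    Spec.map (CommRingCat.ofHom
      (algebraMap ℂ (MvPolynomial.homogeneousSubmodule (Fin (N + 1)) ℂ 0)))

/-- Smooth projective varieties over `ℂ`. -/
structure IsSmoothProjectiveVariety (X : Scheme.{0}) [X.Over SpecC] : Prop where
  isIntegral : IsIntegral X
  smooth : Smooth (X ↘ SpecC)
  projective : ∃ (N : ℕ) (i : X ⟶ projectiveSpace N),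
    IsClosedImmersion i ∧ i ≫ projectiveSpaceToSpecC N = X ↘ SpecC

/-- Coherent sheaves. On a locally noetherian scheme these are the `𝒪_X`-modules that are locally
cokernels of morphisms between free modules of finite rank. -/
def isCoherent (X : Scheme.{0}) : ObjectProperty X.Modules :=
  fun M => SheafOfModules.IsFinitePresentation (R := X.ringCatSheaf) M

variable (X : Scheme.{0}) [X.Over SpecC]

/-- The constants `ℂ ⟶ Γ(X, U)`. -/
def constants (U : X.Opens) : ℂ →+* Γ(X, U) :=
  (X.presheaf.map (homOfLE (le_top : U ≤ ⊤)).op).hom.comp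
    ((X ↘ SpecC).appTop.hom.comp (Scheme.ΓSpecIso (CommRingCat.of ℂ)).inv.hom)

theorem constants_restrict {U V : X.Opens} (i : U ⟶ V) (c : ℂ) :
    X.presheaf.map i.op (constants X V c) = constants X U c := by
  have h : X.presheaf.map (homOfLE (le_top : V ≤ ⊤)).op ≫ X.presheaf.map i.op =
      X.presheaf.map (homOfLE (le_top : U ≤ ⊤)).op := (X.presheaf.map_comp _ _).symm
  exact congrArg (fun f => f.hom ((X ↘ SpecC).appTop.hom
    ((Scheme.ΓSpecIso (CommRingCat.of ℂ)).inv.hom c))) h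

/-- Multiplication by a constant, as an endomorphism of an `𝒪_X`-module. -/
def constSMul (c : ℂ) (M : X.Modules) : M ⟶ M :=
  SheafOfModules.Hom.mk (PresheafOfModules.homMk
    { app := fun U => M.smul (constants X U.unop c)
      naturality := fun U V i => by
        have h := Scheme.Modules.map_comp_smul (M := M) i.unop (constants X U.unop c)
        rw [constants_restrict] at h
        exact h.symm }
    (fun U r m => by
      change constants X U.unop c • (show Γ(X, U.unop) from r) • (show Γ(M, U.unop) from m) =
        (show Γ(X, U.unop) from r) • constants X U.unop c • (show Γ(M, U.unop) from m)
      rw [smul_comm]))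

theorem constSMul_app (c : ℂ) (M : X.Modules) (U : X.Opens) (x : Γ(M, U)) :
    (constSMul X c M).app U x = constants X U c • x := rfl

/-- The action of `ℂ` on the category of `𝒪_X`-modules. -/
def constCenter : ℂ →+* CatCenter X.Modules where
  toFun c :=
    { app := fun M => constSMul X c M
      naturality := fun M N f => by
        apply Scheme.Modules.hom_ext
        intro U
        ext x
        exact (Scheme.Modules.Hom.app_smul f (constants X U c) x).symm }
  map_one' := by
    ext M U x
    change constants X U 1 • x = x
    rw [map_one, one_smul]
  map_mul' a b := by
    ext M U x
    change constants X U (a * b) • x = constants X U a • constants X U b • x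
    rw [map_mul, mul_smul]
  map_zero' := by
    ext M U x
    change constants X U 0 • x = 0
    rw [map_zero, zero_smul]
  map_add' a b := by
    ext M U x
    change constants X U (a + b) • x = constants X U a • x + constants X U b • x
    rw [map_add, add_smul]

/-- The `ℂ`-linear structure on the category of `𝒪_X`-modules. -/
instance : Linear ℂ X.Modules := Linear.ofRingMorphism (constCenter X)

theorem smul_app (c : ℂ) {M N : X.Modules} (f : M ⟶ N) (U : X.Opens) (x : Γ(M, U)) :
    (c • f).app U x = constants X U c • f.app U x := by
  exact Scheme.Modules.Hom.app_smul f (constants X U c) x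

instance : HasExt.{1} X.Modules := HasExt.standard _

end Geometry

end NCHull

end

/-!
Let `⟨E⟩` be the extension closure of a simple collection `E`. Call an object `M` *`n`-stable* if
`Hom (E^(n), M) = Hom (E^(m), M)` along the projections for all `m ≥ n`. The proof shows that
`E^(n)` is a projective generator of the `n`-stable objects of `⟨E⟩`, so that, as in Morita theory,
`T ↦ T ⊗ E^(n)` is an equivalence from the finite dimensional right `R^(n)`-modules to the
`n`-stable objects, with quasi-inverse `Hom (E^(n), -)`; and every object of `⟨E⟩` is `n`-stable for
some `n`.

The category is an arbitrary `K`-linear abelian category with coproducts until the last sections.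

* `⟨E⟩` is closed under kernels and cokernels
  (`IsSimpleCollection.extClosure_kernel_cokernel`), since a nonzero morphism from some `E i` to an
  object of `⟨E⟩` is a monomorphism with cokernel in `⟨E⟩`.
* The extension class of a universal extension corresponds to identities. Hence
  `Hom (E_i^(n), E j) ⟶ Hom (E_i^(n+1), E j)` is bijective and
  `Ext¹ (E_i^(n), E j) ⟶ Ext¹ (E_i^(n+1), E j)` is zero. By dévissage, every `M` in `⟨E⟩` is
  `n`-stable for some `n` (`exists_isStable`), and for every `n` its classes in `Ext¹ (E^(n), M)`
  die on some `E^(m)` (`exists_isKilled`). So a morphism from `E^(n)` to the quotient in a short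
  exact sequence in `⟨E⟩` lifts to some `E^(m)`, and the lift descends to `E^(n)` if the middle
  term is `n`-stable (`exists_lift`). This is the projectivity of `E^(n)`; it also gives that
  `E^(n)` generates the `n`-stable objects (`eq_zero_of_forall`). Moreover `E^(n)` is itself
  `n`-stable (`isStable_total`).
* A presentation of an `n`-stable `M` by sums of copies of `E^(n)` shows that morphisms from `M` are
  the `R^(n)`-linear maps from `Hom (E^(n), M)` (`bijective_map`), and a presentation of a module
  `T` shows that `T` is some `Hom (E^(n), M)` (`exists_iso_hom`). So the unit and the counit of the
  tensor-hom adjunction are isomorphisms (`isIso_unit`, `isIso_counit`).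
* The map `R^nc ⟶ R^(n)` is surjective (`hullProj_surjective`), and the kernel of `E^(N) ⟶ E^(n)`
  is generated by `E^(N)`, hence by images of endomorphisms that act as zero on `E^(n)`. Therefore a
  map of modules over `R^nc` between an `R^(n)`-module `T` and an `R^(m)`-module `U` induces a
  morphism `T ⊗ E^(n) ⟶ U ⊗ E^(m)` (`exists_isInduced`), which gives `Φ` and its compatibilities
  (`phi`). Two nilpotent modules come from the same `R^(n)`, so that every such `Φ` is an
  equivalence (`Phi.isEquivalence`).

The above concerns the extension closure in the category of all `𝒪_X`-modules. It is the extension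
closure in the coherent sheaves (`extensionClosure_iff`), as sheaves of modules of finite
presentation are closed under extensions (`isFinitePresentation_of_shortExact`): locally, the
generators and relations of the quotient lift, because epimorphisms of sheaves are surjective on
sections locally (`exists_lift_section`), and the lifts combine with a presentation of the subsheaf
(`exact_horseshoe`).
-/

noncomputable section

namespace NCHull

universe w v u

/-! ### Kernels and cokernels in the extension closure of a simple collection -/

section Wide

variable {C : Type u} [Category.{v} C] [Abelian C]

/-- An exact sequence `0 ⟶ X₁ ⟶ X₂ ⟶ X₃ ⟶ Y` yields `0 ⟶ X₁ ⟶ X₂ ⟶ ker (X₃ ⟶ Y) ⟶ 0`. -/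
lemma shortExact_kernel_lift {X₁ X₂ X₃ Y : C} {f : X₁ ⟶ X₂} {g : X₂ ⟶ X₃} {h : X₃ ⟶ Y}
    (w : f ≫ g = 0) (w' : g ≫ h = 0) [Mono f] (hf : (ShortComplex.mk f g w).Exact)
    (hg : (ShortComplex.mk g h w').Exact) :
    (ShortComplex.mk f (kernel.lift h g w')
      (by rw [← cancel_mono (kernel.ι h)]; simpa using w)).ShortExact := by
  have : Epi (kernel.lift h g w') := (ShortComplex.exact_iff_epi_kernel_lift _).1 hg
  refine ShortComplex.ShortExact.mk ?_
  rw [ShortComplex.exact_iff_of_epi_of_isIso_of_mono (φ :=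
    ({ τ₁ := 𝟙 _, τ₂ := 𝟙 _, τ₃ := kernel.ι h } : ShortComplex.mk f (kernel.lift h g w')
      (by rw [← cancel_mono (kernel.ι h)]; simpa using w) ⟶ ShortComplex.mk f g w))]
  exact hf

variable {J : Type*} (E : J → C)

/-- The extension closure of the `E i` in the whole category `C`. -/
abbrev extClosure : ObjectProperty C := extensionClosure ⊤ E

variable {E}

lemma extClosure_of_shortExact {S : ShortComplex C} (hS : S.ShortExact)
    (h₁ : extClosure E S.X₁) (h₃ : extClosure E S.X₃) : extClosure E S.X₂ :=
  .extension S hS trivial h₁ h₃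

instance : (extClosure E).IsClosedUnderExtensions where
  prop_X₂_of_shortExact hS h₁ h₃ := extClosure_of_shortExact hS h₁ h₃

lemma extClosure_of_iso {M N : C} (e : M ≅ N) (hM : extClosure E M) : extClosure E N := by
  open scoped ZeroObject in
  -- `N` is an extension of a zero object by `M`
  let S : ShortComplex C := ShortComplex.mk e.hom (0 : N ⟶ 0) comp_zero
  have hS : S.ShortExact :=
    { exact := by
        rw [S.exact_iff_epi rfl]
        dsimp [S]; infer_instance
      mono_f := by dsimp [S]; infer_instance
      epi_g := ⟨fun _ _ _ => (isZero_zero C).eq_of_src _ _⟩ }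
  exact extClosure_of_shortExact hS hM (.zero _ (isZero_zero C))

instance : (extClosure E).IsClosedUnderIsomorphisms where
  of_iso e h := extClosure_of_iso e h

/-- If `A` is closed under extensions and contains the `E i`, then forming the extension closure
inside `A` or inside the whole category makes no difference. -/
lemma extensionClosure_iff (A : ObjectProperty C) [A.IsClosedUnderExtensions]
    (hA : ∀ M, IsZero M → A M) (hE : ∀ i, A (E i)) (M : C) :
    extensionClosure A E M ↔ extClosure E M := by
  constructor
  · intro h
    induction h with
    | zero M hM => exact .zero M hM
    | of i => exact .of i
    | extension S hS _ _ _ h₁ h₃ => exact extClosure_of_shortExact hS h₁ h₃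
  · intro h
    suffices extensionClosure A E M ∧ A M from this.1
    induction h with
    | zero M hM => exact ⟨.zero M hM, hA M hM⟩
    | of i => exact ⟨.of i, hE i⟩
    | extension S hS _ _ _ h₁ h₃ =>
      have := A.prop_X₂_of_shortExact hS h₁.2 h₃.2
      exact ⟨.extension S hS this h₁.1 h₃.1, this⟩

instance : (extClosure E).ContainsZero where
  exists_zero := ⟨_, isZero_zero C, .zero _ (isZero_zero C)⟩

instance : (extClosure E).IsClosedUnderBinaryProducts where
  limitsOfShape_le := by
    rintro X ⟨p⟩
    have hB := (extClosure E).prop_biprod (p.prop_diag_obj ⟨.left⟩) (p.prop_diag_obj ⟨.right⟩)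
    refine extClosure_of_iso ?_ hB
    refine (biprod.isoProd _ _).trans ?_
    refine HasLimit.isoOfNatIso (diagramIsoPair p.diag).symm ≪≫ ?_
    exact (limit.isLimit _).conePointUniqueUpToIso p.isLimit

instance : (extClosure E).IsClosedUnderFiniteProducts :=
  ObjectProperty.IsClosedUnderFiniteProducts.mk'

lemma extClosure_biproduct {ι : Type*} [Finite ι] (f : ι → C) [HasBiproduct f]
    (hf : ∀ i, extClosure E (f i)) : extClosure E (⨁ f) :=
  (extClosure E).prop_of_isLimit_fan (F := (biproduct.bicone f).toCone) (biproduct.isLimit f) hf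

section KernelCokernel

variable {X Y Z : C} (f : X ⟶ Y) (g : Y ⟶ Z)

/-- The morphism `coker f ⟶ coker (f ≫ g)` induced by `g`. -/
abbrev cokernelMapComp : cokernel f ⟶ cokernel (f ≫ g) :=
  cokernel.map f (f ≫ g) (𝟙 _) g (by simp)

/-- The short exact sequence is `0 ⟶ ker (f ≫ g) ⟶ ker g ⟶ ker (coker f ⟶ coker (f ≫ g)) ⟶ 0`. -/
lemma extClosure_kernel_of_comp [Mono f] (h₁ : extClosure E (kernel (f ≫ g)))
    (h₂ : extClosure E (kernel (cokernelMapComp f g))) : extClosure E (kernel g) := by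
  have e₀ := (kernelCokernelCompSequence_exact f g).exact 0
  have e₁ := (kernelCokernelCompSequence_exact f g).exact 1
  have e₂ := (kernelCokernelCompSequence_exact f g).exact 2
  have hm : Mono (kernel.map (f ≫ g) g f (𝟙 _) (by simp)) :=
    (ShortComplex.exact_iff_mono _ ((isZero_kernel_of_mono f).eq_of_src _ _)).1 e₀
  exact extClosure_of_shortExact (shortExact_kernel_lift
    (f := kernel.map (f ≫ g) g f (𝟙 _) _) (g := kernelCokernelCompSequence.δ f g)
    (h := cokernelMapComp f g) _ _ e₁ e₂) h₁ h₂

/-- `coker g` is also the cokernel of `coker f ⟶ coker (f ≫ g)`. -/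
def cokernelIsoOfComp : cokernel (cokernelMapComp f g) ≅ cokernel g := by
  have e₃ := (kernelCokernelCompSequence_exact f g).exact 3
  have : Epi (cokernel.map (f ≫ g) g f (𝟙 _) (by simp)) :=
    inferInstanceAs (Epi ((kernelCokernelCompSequence f g).map' 4 5))
  exact (colimit.isColimit _).coconePointUniqueUpToIso
    (ShortComplex.Exact.gIsCokernel e₃)

/-- The short exact sequence is `0 ⟶ coker f ⟶ coker (f ≫ g) ⟶ coker g ⟶ 0`. -/
lemma extClosure_cokernel_comp_of_mono [Mono g] (h₁ : extClosure E (cokernel f))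
    (h₂ : extClosure E (cokernel g)) : extClosure E (cokernel (f ≫ g)) := by
  have e₂ := (kernelCokernelCompSequence_exact f g).exact 2
  have e₃ := (kernelCokernelCompSequence_exact f g).exact 3
  have : Epi (cokernel.map (f ≫ g) g f (𝟙 _) (by simp)) :=
    inferInstanceAs (Epi ((kernelCokernelCompSequence f g).map' 4 5))
  have : Mono (cokernelMapComp f g) :=
    (ShortComplex.exact_iff_mono _ ((isZero_kernel_of_mono g).eq_of_src _ _)).1 e₂
  exact extClosure_of_shortExact
    (ShortComplex.ShortExact.mk' e₃ ‹Mono (cokernelMapComp f g)› ‹_›) h₁ h₂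

/-- The short exact sequence is `0 ⟶ ker g ⟶ coker f ⟶ coker (f ≫ g) ⟶ 0`. -/
lemma extClosure_cokernel_of_comp [Mono (f ≫ g)] [Epi g] (h₁ : extClosure E (kernel g))
    (h₂ : extClosure E (cokernel (f ≫ g))) : extClosure E (cokernel f) := by
  have e₁ := (kernelCokernelCompSequence_exact f g).exact 1
  have e₂ := (kernelCokernelCompSequence_exact f g).exact 2
  have e₃ := (kernelCokernelCompSequence_exact f g).exact 3
  have : Mono (kernelCokernelCompSequence.δ f g) :=
    (ShortComplex.exact_iff_mono _ ((isZero_kernel_of_mono (f ≫ g)).eq_of_src _ _)).1 e₁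
  have : Epi (cokernelMapComp f g) :=
    (ShortComplex.exact_iff_epi _ ((isZero_cokernel_of_epi g).eq_of_tgt _ _)).1 e₃
  exact extClosure_of_shortExact (ShortComplex.ShortExact.mk' e₂
    ‹Mono (kernelCokernelCompSequence.δ f g)› ‹Epi (cokernelMapComp f g)›) h₁ h₂

end KernelCokernel

lemma IsSimpleCollection.isIso_or_eq_zero {K : Type*} [Field K] [Linear K C]
    (hE : IsSimpleCollection K E) {i j : J} (f : E i ⟶ E j) : f = 0 ∨ IsIso f := by
  by_cases hij : i = j
  · subst hij
    obtain ⟨c, rfl⟩ := (hE.bijective_algebraMap i).2 f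
    by_cases hc : c = 0
    · left; rw [hc, map_zero]
    · right
      have h := (IsUnit.mk0 c hc).map (algebraMap K (End (E i)))
      exact (isUnit_iff_isIso _).1 h
  · exact .inl (hE.eq_zero hij f)

/-- A nonzero morphism from some `E i` to an object of the extension closure is a monomorphism, and
its cokernel is in the extension closure. -/
lemma IsSimpleCollection.eq_zero_or_mono {K : Type*} [Field K] [Linear K C]
    (hE : IsSimpleCollection K E) {N : C} (hN : extClosure E N) {i : J} (f : E i ⟶ N) :
    f = 0 ∨ (Mono f ∧ extClosure E (cokernel f)) := by
  induction hN with
  | zero M hM => exact .inl (hM.eq_of_tgt _ _)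
  | of j =>
    obtain h | h := hE.isIso_or_eq_zero f
    · exact .inl h
    · exact .inr ⟨inferInstance, .zero _ (isZero_cokernel_of_epi f)⟩
  | extension S hS _ h₁ h₃ ih₁ ih₃ =>
    have := hS.mono_f
    have := hS.epi_g
    obtain h | ⟨h, h'⟩ := ih₃ (f ≫ S.g)
    · obtain ⟨f', rfl⟩ : ∃ f', f' ≫ S.f = f := ⟨hS.exact.lift f h, hS.exact.lift_f f h⟩
      obtain rfl | ⟨h, h'⟩ := ih₁ f'
      · exact .inl zero_comp
      · refine .inr ⟨inferInstance, extClosure_cokernel_comp_of_mono _ _ h' ?_⟩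
        exact extClosure_of_iso
          (hS.gIsCokernel.coconePointUniqueUpToIso (colimit.isColimit _)) h₃
    · refine .inr ⟨mono_of_mono f S.g, extClosure_cokernel_of_comp f S.g ?_ h'⟩
      exact extClosure_of_iso (hS.fIsKernel.conePointUniqueUpToIso (limit.isLimit _)) h₁

/-- The extension closure of a simple collection is closed under kernels and cokernels. -/
lemma IsSimpleCollection.extClosure_kernel_cokernel {K : Type*} [Field K] [Linear K C]
    (hE : IsSimpleCollection K E) {M N : C} (hM : extClosure E M) (hN : extClosure E N)
    (f : M ⟶ N) : extClosure E (kernel f) ∧ extClosure E (cokernel f) := by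
  induction hM generalizing N with
  | zero M hM =>
    have : Mono f := ⟨fun _ _ _ => hM.eq_of_tgt _ _⟩
    obtain rfl := hM.eq_of_src f 0
    exact ⟨.zero _ (isZero_kernel_of_mono _), extClosure_of_iso cokernelZeroIsoTarget.symm hN⟩
  | of i =>
    obtain rfl | ⟨h, h'⟩ := hE.eq_zero_or_mono hN f
    · exact ⟨extClosure_of_iso kernelZeroIsoSource.symm (.of i),
        extClosure_of_iso cokernelZeroIsoTarget.symm hN⟩
    · exact ⟨.zero _ (isZero_kernel_of_mono _), h'⟩
  | extension S hS _ h₁ h₃ ih₁ ih₃ =>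
    have := hS.mono_f
    have := hS.epi_g
    -- `X₃` is the cokernel of `X₁ ⟶ X₂`, hence the induction hypothesis applies to the morphism
    -- from it to the cokernel of `X₁ ⟶ N`
    have e : S.X₃ ≅ cokernel S.f :=
      hS.gIsCokernel.coconePointUniqueUpToIso (colimit.isColimit _)
    obtain ⟨k₁, c₁⟩ := ih₁ hN (S.f ≫ f)
    obtain ⟨k₃, c₃⟩ := ih₃ c₁ (e.hom ≫ cokernelMapComp S.f f)
    exact ⟨extClosure_kernel_of_comp S.f f k₁ (extClosure_of_iso (kernelIsIsoComp _ _) k₃),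
      extClosure_of_iso (cokernelEpiComp _ _ ≪≫ cokernelIsoOfComp S.f f) c₃⟩

end Wide

/-! ### Lifting along the tower of universal extensions -/

section Tower

variable {K : Type*} [Field K] {C : Type u} [Category.{v} C] [Abelian C] [Linear K C]

/-- `M` is a direct sum of finitely many of the objects `E j`, with projections `p x` and
inclusions `q x`. (The remaining relations between the `p x` and the `q x` play no role.) -/
def IsFiniteSum {J : Type*} (E : J → C) (M : C) : Prop :=
  ∃ (ι : Type) (_ : Fintype ι) (j : ι → J) (p : ∀ x, M ⟶ E (j x)) (q : ∀ x, E (j x) ⟶ M),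
    ∑ x, p x ≫ q x = 𝟙 M

lemma exists_sum_comp_eq_id {ι : Type*} [Fintype ι] {f : ι → C} {F : Fan f} (hF : IsLimit F) :
    ∃ q : ∀ x, f x ⟶ F.pt, ∑ x, F.proj x ≫ q x = 𝟙 F.pt := by
  classical
  let q (x : ι) : f x ⟶ F.pt :=
    Fan.IsLimit.lift hF fun y => if e : x = y then eqToHom (by rw [e]) else 0
  have hq (x y) : q x ≫ F.proj y = if e : x = y then eqToHom (by rw [e]) else 0 :=
    Fan.IsLimit.fac hF _ _
  refine ⟨q, Fan.IsLimit.hom_ext hF _ _ fun y => ?_⟩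
  simp only [Preadditive.sum_comp, Category.assoc, hq]
  rw [Finset.sum_eq_single y]
  · simp
  · intro x _ hx
    simp [hx]
  · simp

variable [HasExt.{w} C]

namespace IsUniversalExtension

variable {k : ℕ} {E : Fin k → C} {S : ShortComplex C}

lemma extClosure_ker (hS : IsUniversalExtension.{w} K E S) : extClosure E S.X₁ := by
  obtain ⟨d, b, p, ⟨hp⟩, h⟩ := hS.exists_basis
  exact (extClosure E).prop_of_isLimit_fan hp fun x => .of _

lemma isFiniteSum_ker (hS : IsUniversalExtension.{w} K E S) : IsFiniteSum E S.X₁ := by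
  obtain ⟨d, b, p, ⟨hp⟩, h⟩ := hS.exists_basis
  obtain ⟨q, hq⟩ := exists_sum_comp_eq_id hp
  exact ⟨_, inferInstance, _, _, q, hq⟩

/-- The connecting map `Hom (ker, E j) ⟶ Ext¹ (S.X₃, E j)` of a universal extension is injective,
since its values on the projections form a basis. Hence morphisms to `E j` vanish on the kernel. -/
lemma exists_factor (hS : IsUniversalExtension.{w} K E S) (hE : IsSimpleCollection K E) {j : Fin k}
    (f : S.X₂ ⟶ E j) : ∃ g, S.g ≫ g = f := by
  classical
  suffices h : S.f ≫ f = 0 by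
    have := hS.shortExact.epi_g
    exact ⟨hS.shortExact.exact.desc f h, hS.shortExact.exact.g_desc f h⟩
  obtain ⟨d, b, p, ⟨hp⟩, h⟩ := hS.exists_basis
  obtain ⟨q, hq⟩ := exists_sum_comp_eq_id hp
  have hc (m : Fin (d j)) : ∃ c : K, q ⟨j, m⟩ ≫ S.f ≫ f = c • 𝟙 (E j) := by
    obtain ⟨c, hc⟩ := (hE.bijective_algebraMap j).2 (q ⟨j, m⟩ ≫ S.f ≫ f)
    exact ⟨c, hc.symm⟩
  choose c hc using hc
  have hf : S.f ≫ f = ∑ m, c m • p j m := by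
    have h' := hq =≫ (S.f ≫ f)
    rw [Preadditive.sum_comp, Fintype.sum_sigma, Finset.sum_eq_single j] at h'
    · refine (Category.id_comp _).symm.trans (h'.symm.trans ?_)
      refine Finset.sum_congr rfl fun m _ => ?_
      rw [Category.assoc, hc, Linear.comp_smul, Category.comp_id]
      rfl
    · intro i _ hi
      refine Finset.sum_eq_zero fun m _ => ?_
      rw [Category.assoc, hE.eq_zero hi (q ⟨i, m⟩ ≫ S.f ≫ f), comp_zero]
    · simp
  have h₀ : ∑ m, c m • b j m = 0 := by
    have h₁ : hS.shortExact.extClass.comp (Ext.mk₀ (S.f ≫ f)) (add_zero 1) = 0 := by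
      rw [← Ext.mk₀_comp_mk₀, ShortComplex.ShortExact.extClass_comp_assoc]
    rw [← h₁, hf, Ext.mk₀_sum, Ext.comp_sum]
    refine Finset.sum_congr rfl fun m _ => ?_
    rw [Ext.mk₀_smul, Ext.comp_smul, h]
  have := Fintype.linearIndependent_iff.1 (b j).linearIndependent c h₀
  simp [hf, this]

/-- Every class in `Ext¹ (S.X₃, E j)` is a pushout of the class of the universal extension, hence
becomes zero on the middle term. -/
lemma comp_eq_zero (hS : IsUniversalExtension.{w} K E S) {j : Fin k}
    (x : Ext.{w} S.X₃ (E j) 1) : (Ext.mk₀ S.g).comp x (zero_add 1) = 0 := by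
  obtain ⟨d, b, p, ⟨hp⟩, h⟩ := hS.exists_basis
  rw [← (b j).sum_repr x]
  simp only [Ext.comp_sum, Ext.comp_smul, ← h]
  simp

end IsUniversalExtension

namespace UniversalExtensionTower

attribute [local instance] Abelian.hasFiniteBiproducts

variable {k : ℕ} {E : Fin k → C} (t : UniversalExtensionTower.{w} K E)

lemma shortExact (n : ℕ) (i : Fin k) :
    (ShortComplex.mk (t.ι n i) (t.π n i) (t.ι_π n i)).ShortExact :=
  (t.isUniversalExtension n i).shortExact

lemma extClosure_obj (n : ℕ) (i : Fin k) : extClosure E (t.obj n i) := by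
  induction n with
  | zero => exact extClosure_of_iso (t.objZero i).symm (.of i)
  | succ n ih =>
    exact extClosure_of_shortExact (t.shortExact n i)
      (t.isUniversalExtension n i).extClosure_ker ih

lemma extClosure_total (n : ℕ) : extClosure E (t.total n) :=
  extClosure_biproduct _ (t.extClosure_obj n)

instance epi_π (n : ℕ) (i : Fin k) : Epi (t.π n i) := (t.shortExact n i).epi_g

/-- The inclusion `E_i^(n) ⟶ E^(n)`. -/
def incl (n : ℕ) (i : Fin k) : t.obj n i ⟶ t.total n := biproduct.ι (t.obj n) i

/-- The projection `E^(n) ⟶ E_i^(n)`. -/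
def pr (n : ℕ) (i : Fin k) : t.total n ⟶ t.obj n i := biproduct.π (t.obj n) i

lemma incl_pr (n : ℕ) (i : Fin k) : t.incl n i ≫ t.pr n i = 𝟙 _ := biproduct.ι_π_self _ _

instance epi_pr (n : ℕ) (i : Fin k) : Epi (t.pr n i) :=
  epi_of_epi_fac (t.incl_pr n i)

lemma sum_pr_incl (n : ℕ) : ∑ i, t.pr n i ≫ t.incl n i = 𝟙 (t.total n) := biproduct.total

lemma incl_totalπ (n : ℕ) (i : Fin k) :
    t.incl (n + 1) i ≫ t.totalπ n = t.π n i ≫ t.incl n i :=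
  biproduct.ι_map _ _

lemma total_hom_ext {n : ℕ} {M : C} {f g : t.total n ⟶ M}
    (h : ∀ i, t.incl n i ≫ f = t.incl n i ≫ g) : f = g :=
  biproduct.hom_ext' _ _ h

lemma exists_desc {n : ℕ} {M : C} (f : ∀ i, t.obj n i ⟶ M) :
    ∃ g : t.total n ⟶ M, ∀ i, t.incl n i ≫ g = f i :=
  ⟨biproduct.desc f, fun i => biproduct.ι_desc f i⟩

instance epi_totalπ (n : ℕ) : Epi (t.totalπ n) :=
  ⟨fun f g h => t.total_hom_ext fun i => by
    have h' := t.incl (n + 1) i ≫= h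
    rwa [← Category.assoc, ← Category.assoc, incl_totalπ, Category.assoc, Category.assoc,
      cancel_epi] at h'⟩

/-- The projection `E^(n) ⟶ E^(m)` for `m ≤ n`. -/
def proj {m n : ℕ} (h : m ≤ n) : t.total n ⟶ t.total m :=
  (Functor.ofOpSequence t.totalπ).map (homOfLE h).op

@[simp]
lemma proj_self (n : ℕ) : t.proj (le_refl n) = 𝟙 _ :=
  (Functor.ofOpSequence t.totalπ).map_id ⟨n⟩

lemma proj_succ (n : ℕ) : t.proj (Nat.le_add_right n 1) = t.totalπ n :=
  Functor.ofOpSequence_map_homOfLE_succ t.totalπ n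

lemma proj_proj {l m n : ℕ} (h : l ≤ m) (h' : m ≤ n) :
    t.proj h' ≫ t.proj h = t.proj (h.trans h') :=
  ((Functor.ofOpSequence t.totalπ).map_comp (homOfLE h').op (homOfLE h).op).symm

lemma proj_proj_assoc {l m n : ℕ} (h : l ≤ m) (h' : m ≤ n) {M : C} (f : t.total l ⟶ M) :
    t.proj h' ≫ t.proj h ≫ f = t.proj (h.trans h') ≫ f := by
  rw [← Category.assoc, proj_proj]

instance epi_proj {m n : ℕ} (h : m ≤ n) : Epi (t.proj h) := by
  induction n, h using Nat.le_induction with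
  | base => rw [proj_self]; infer_instance
  | succ n h ih =>
    rw [← t.proj_proj h (Nat.le_add_right n 1), proj_succ]
    infer_instance

/-- `M` is `n`-stable if `Hom (E^(n), M) = Hom (E^(m), M)` for all `m ≥ n`. -/
def IsStable (n : ℕ) (M : C) : Prop :=
  ∀ ⦃m : ℕ⦄ (h : n ≤ m) (f : t.total m ⟶ M), ∃ g, t.proj h ≫ g = f

/-- The maps `Ext¹ (E^(n), M) ⟶ Ext¹ (E^(m), M)` induced by the projections are zero for
`m ≥ n + d`. -/
def IsKilled (d : ℕ) (M : C) : Prop :=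
  ∀ ⦃n m : ℕ⦄ (h : n + d ≤ m) (x : Ext.{w} (t.total n) M 1),
    (Ext.mk₀ (t.proj ((Nat.le_add_right n d).trans h))).comp x (zero_add 1) = 0

variable {t}

lemma IsStable.mono {n n' : ℕ} {M : C} (hM : t.IsStable n M) (h : n ≤ n') : t.IsStable n' M := by
  intro m hm f
  obtain ⟨g, rfl⟩ := hM (h.trans hm) f
  exact ⟨t.proj h ≫ g, by rw [proj_proj_assoc]⟩

lemma isStable_of_isZero {M : C} (hM : IsZero M) (n : ℕ) : t.IsStable n M :=
  fun _ _ _ => ⟨0, hM.eq_of_tgt _ _⟩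

lemma IsStable.of_sum {n : ℕ} {M : C} {ι : Type*} [Fintype ι] {N : ι → C}
    (p : ∀ x, M ⟶ N x) (q : ∀ x, N x ⟶ M) (h : ∑ x, p x ≫ q x = 𝟙 M)
    (hN : ∀ x, t.IsStable n (N x)) : t.IsStable n M := by
  intro m hm f
  choose g hg using fun x => hN x hm (f ≫ p x)
  refine ⟨∑ x, g x ≫ q x, ?_⟩
  rw [Preadditive.comp_sum, ← Category.comp_id f, ← h, Preadditive.comp_sum]
  exact Finset.sum_congr rfl fun x _ => by rw [← Category.assoc, hg, Category.assoc]

lemma IsKilled.of_sum {d : ℕ} {M : C} {ι : Type*} [Fintype ι] {N : ι → C}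
    (p : ∀ x, M ⟶ N x) (q : ∀ x, N x ⟶ M) (h : ∑ x, p x ≫ q x = 𝟙 M)
    (hN : ∀ x, t.IsKilled d (N x)) : t.IsKilled d M := by
  intro n m hm x
  rw [← x.comp_mk₀_id, ← h, Ext.mk₀_sum, Ext.comp_sum, Ext.comp_sum]
  refine Finset.sum_eq_zero fun i _ => ?_
  rw [← Ext.mk₀_comp_mk₀, ← Ext.comp_assoc_of_third_deg_zero _ (Ext.mk₀ (p i)),
    ← Ext.comp_assoc_of_third_deg_zero, hN i hm, Ext.zero_comp]

lemma isKilled_of_isZero {M : C} (hM : IsZero M) (d : ℕ) : t.IsKilled d M := by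
  intro n m _ x
  rw [← x.comp_mk₀_id, hM.eq_of_src (𝟙 M) 0]
  simp

/-- The obstruction against a lift is a class in `Ext¹ (E^(n), S.X₁)`. -/
lemma IsKilled.exists_lift {d n : ℕ} {S : ShortComplex C} (hS : S.ShortExact)
    (h₁ : t.IsKilled d S.X₁) (f : t.total n ⟶ S.X₃) :
    ∃ g : t.total (n + d) ⟶ S.X₂, g ≫ S.g = t.proj (Nat.le_add_right n d) ≫ f := by
  have h := h₁ (le_refl (n + d)) ((Ext.mk₀ f).comp hS.extClass (zero_add 1))
  rw [Ext.mk₀_comp_mk₀_assoc] at h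
  obtain ⟨y, hy⟩ := Ext.covariant_sequence_exact₃ _ hS _ (zero_add 1) h
  obtain ⟨g, rfl⟩ := (Ext.mk₀_bijective _ _).2 y
  rw [Ext.mk₀_comp_mk₀] at hy
  exact ⟨g, (Ext.mk₀_bijective _ _).1 hy⟩

lemma IsKilled.extension {d₁ d₃ : ℕ} {S : ShortComplex C} (hS : S.ShortExact)
    (h₁ : t.IsKilled d₁ S.X₁) (h₃ : t.IsKilled d₃ S.X₃) : t.IsKilled (d₃ + d₁) S.X₂ := by
  intro n m hm x
  have h := h₃ (le_refl (n + d₃)) (x.comp (Ext.mk₀ S.g) (add_zero 1))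
  rw [← Ext.comp_assoc_of_third_deg_zero] at h
  obtain ⟨y, hy⟩ := Ext.covariant_sequence_exact₂ _ hS _ h
  have hm' : n + d₃ + d₁ ≤ m := by rwa [add_assoc]
  rw [← t.proj_proj (Nat.le_add_right n d₃) ((Nat.le_add_right _ d₁).trans hm'),
    ← Ext.mk₀_comp_mk₀_assoc, ← hy, ← Ext.comp_assoc_of_third_deg_zero, h₁ hm', Ext.zero_comp]

lemma IsStable.extension {n₁ d₁ n₃ n : ℕ} {S : ShortComplex C} (hS : S.ShortExact)
    (h₁ : t.IsStable n₁ S.X₁) (h₁' : t.IsKilled d₁ S.X₁) (h₃ : t.IsStable n₃ S.X₃)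
    (hn₁ : n₁ ≤ n) (hn₃ : n₃ + d₁ ≤ n) : t.IsStable n S.X₂ := by
  have := hS.mono_f
  intro m hm f
  obtain ⟨g, hg⟩ := h₃ (((Nat.le_add_right _ _).trans hn₃).trans hm) (f ≫ S.g)
  obtain ⟨g', hg'⟩ := h₁'.exists_lift hS g
  -- `f` and the lift `g'` of `g` agree on `S.X₃`, so their difference comes from `S.X₁`
  let r : t.total m ⟶ S.X₂ := f - t.proj (hn₃.trans hm) ≫ g'
  have hr : r ≫ S.g = 0 := by
    rw [Preadditive.sub_comp, Category.assoc, hg', proj_proj_assoc, hg, sub_self]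
  obtain ⟨s, hs⟩ := h₁.mono hn₁ hm (hS.exact.lift r hr)
  refine ⟨s ≫ S.f + t.proj hn₃ ≫ g', ?_⟩
  rw [Preadditive.comp_add, ← Category.assoc, hs, hS.exact.lift_f, proj_proj_assoc,
    sub_add_cancel]

lemma IsStable.X₁ {n : ℕ} {S : ShortComplex C} (hS : S.ShortExact) (h₂ : t.IsStable n S.X₂) :
    t.IsStable n S.X₁ := by
  have := hS.mono_f
  intro m hm f
  obtain ⟨g, hg⟩ := h₂ hm (f ≫ S.f)
  have hg' : g ≫ S.g = 0 := by
    rw [← cancel_epi (t.proj hm), ← Category.assoc, hg, Category.assoc, S.zero, comp_zero,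
      comp_zero]
  refine ⟨hS.exact.lift g hg', ?_⟩
  rw [← cancel_mono S.f, Category.assoc, hS.exact.lift_f, hg]

/-- `E^(n)` behaves like a projective object with respect to `n`-stable objects. -/
lemma IsStable.exists_lift {n d : ℕ} {S : ShortComplex C} (hS : S.ShortExact)
    (h₁ : t.IsKilled d S.X₁) (h₂ : t.IsStable n S.X₂) (f : t.total n ⟶ S.X₃) :
    ∃ g, g ≫ S.g = f := by
  obtain ⟨g, hg⟩ := h₁.exists_lift hS f
  obtain ⟨g', rfl⟩ := h₂ (Nat.le_add_right n d) g
  exact ⟨g', by rwa [Category.assoc, cancel_epi] at hg⟩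

lemma IsStable.X₃ {n d : ℕ} {S : ShortComplex C} (hS : S.ShortExact)
    (h₁ : t.IsKilled d S.X₁) (h₂ : t.IsStable n S.X₂) : t.IsStable n S.X₃ := by
  intro m hm f
  obtain ⟨g, rfl⟩ := (h₂.mono hm).exists_lift hS h₁ f
  obtain ⟨g', rfl⟩ := h₂ hm g
  exact ⟨g' ≫ S.g, (Category.assoc _ _ _).symm⟩

variable (t)

/-- Classes in `Ext¹ (E_i^(n), E j)` become zero on the universal extension `E_i^(n+1)`. -/
lemma isKilled_simple (j : Fin k) : t.IsKilled 1 (E j) := by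
  intro n m hm x
  suffices h : (Ext.mk₀ (t.totalπ n)).comp x (zero_add 1) = 0 by
    rw [← t.proj_proj (Nat.le_add_right n 1) hm, ← Ext.mk₀_comp_mk₀_assoc, proj_succ, h,
      Ext.comp_zero]
  rw [← Ext.mk₀_id_comp ((Ext.mk₀ (t.totalπ n)).comp x (zero_add 1)), ← sum_pr_incl,
    Ext.mk₀_sum, Ext.sum_comp]
  refine Finset.sum_eq_zero fun i _ => ?_
  have h := (t.isUniversalExtension n i).comp_eq_zero
    ((Ext.mk₀ (t.incl n i)).comp x (zero_add 1))
  dsimp only at h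
  rw [Ext.mk₀_comp_mk₀_assoc, Category.assoc, incl_totalπ, ← Ext.mk₀_comp_mk₀_assoc,
    ← Ext.mk₀_comp_mk₀_assoc, h, Ext.comp_zero]

lemma isStable_simple (hE : IsSimpleCollection K E) (j : Fin k) : t.IsStable 0 (E j) := by
  intro m hm f
  induction m with
  | zero => exact ⟨f, by simp⟩
  | succ m ih =>
    choose g hg using fun i => (t.isUniversalExtension m i).exists_factor hE
      (t.incl (m + 1) i ≫ f)
    obtain ⟨g₁, hg₁⟩ := t.exists_desc g
    obtain ⟨g', hg'⟩ := ih (Nat.zero_le m) g₁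
    refine ⟨g', ?_⟩
    rw [← t.proj_proj (Nat.zero_le m) (Nat.le_add_right m 1), Category.assoc, hg', proj_succ]
    refine t.total_hom_ext fun i => ?_
    rw [← Category.assoc, incl_totalπ, Category.assoc, hg₁, ← hg]

lemma isStable_obj (hE : IsSimpleCollection K E) (n : ℕ) (i : Fin k) :
    t.IsStable n (t.obj n i) := by
  induction n with
  | zero =>
    refine IsStable.of_sum (ι := Unit) (fun _ => (t.objZero i).hom) (fun _ => (t.objZero i).inv)
      (by simp) fun _ => t.isStable_simple hE i
  | succ n ih =>
    obtain ⟨ι, _, j, p, q, h⟩ := (t.isUniversalExtension n i).isFiniteSum_ker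
    exact IsStable.extension (t.shortExact n i)
      (IsStable.of_sum p q h fun x => t.isStable_simple hE _)
      (IsKilled.of_sum p q h fun x => t.isKilled_simple _) ih (Nat.zero_le _) le_rfl

lemma isStable_total (hE : IsSimpleCollection K E) (n : ℕ) : t.IsStable n (t.total n) :=
  IsStable.of_sum (t.pr n) (t.incl n) (t.sum_pr_incl n)
    fun i => t.isStable_obj hE n i

lemma exists_isKilled {M : C} (hM : extClosure E M) : ∃ d, t.IsKilled d M := by
  induction hM with
  | zero M hM => exact ⟨0, isKilled_of_isZero hM 0⟩
  | of i => exact ⟨1, t.isKilled_simple i⟩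
  | extension S hS _ _ _ h₁ h₃ =>
    obtain ⟨d₁, h₁⟩ := h₁
    obtain ⟨d₃, h₃⟩ := h₃
    exact ⟨d₃ + d₁, .extension hS h₁ h₃⟩

lemma exists_isStable (hE : IsSimpleCollection K E) {M : C} (hM : extClosure E M) :
    ∃ n, t.IsStable n M := by
  induction hM with
  | zero M hM => exact ⟨0, isStable_of_isZero hM 0⟩
  | of i => exact ⟨0, t.isStable_simple hE i⟩
  | extension S hS _ h _ h₁ h₃ =>
    obtain ⟨d₁, hd⟩ := t.exists_isKilled h
    obtain ⟨n₁, h₁⟩ := h₁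
    obtain ⟨n₃, h₃⟩ := h₃
    exact ⟨_, .extension hS h₁ hd h₃ (le_max_left _ _) (le_max_right _ _)⟩

/-- For a short exact sequence in the extension closure with `n`-stable middle term, every morphism
from `E^(n)` to the quotient lifts. -/
lemma exists_lift {n : ℕ} {S : ShortComplex C} (hS : S.ShortExact) (h₁ : extClosure E S.X₁)
    (h₂ : t.IsStable n S.X₂) (f : t.total n ⟶ S.X₃) : ∃ g, g ≫ S.g = f := by
  obtain ⟨d, hd⟩ := t.exists_isKilled h₁
  exact h₂.exists_lift hS hd f

lemma isStable_X₃ {n : ℕ} {S : ShortComplex C} (hS : S.ShortExact) (h₁ : extClosure E S.X₁)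
    (h₂ : t.IsStable n S.X₂) : t.IsStable n S.X₃ := by
  obtain ⟨d, hd⟩ := t.exists_isKilled h₁
  exact h₂.X₃ hS hd

/-- An `n`-stable object of the extension closure is generated by `E^(n)`. -/
lemma eq_zero_of_forall {M : C} (hM : extClosure E M) {n : ℕ} (h : t.IsStable n M) {Y : C}
    (f : M ⟶ Y) (hf : ∀ x : t.total n ⟶ M, x ≫ f = 0) : f = 0 := by
  induction hM generalizing Y with
  | zero M hM => exact hM.eq_of_src _ _
  | of i =>
    rw [← cancel_epi (t.proj (Nat.zero_le n) ≫ t.pr 0 i ≫ (t.objZero i).hom),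
      hf, comp_zero]
  | extension S hS _ h₁ h₃ ih₁ ih₃ =>
    have := hS.epi_g
    have hf₁ : S.f ≫ f = 0 := ih₁ (h.X₁ hS) _ fun x => by rw [← Category.assoc, hf]
    obtain ⟨f', rfl⟩ : ∃ f', S.g ≫ f' = f := ⟨hS.exact.desc f hf₁, hS.exact.g_desc f hf₁⟩
    rw [ih₃ (t.isStable_X₃ hS h₁ h) f' fun x => ?_, comp_zero]
    obtain ⟨y, rfl⟩ := t.exists_lift hS h₁ h x
    rw [Category.assoc, hf]

/-- By dévissage this reduces to the spaces `Hom (E i, E j)`, which are at most one dimensional. -/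
lemma finiteDimensional_hom (hE : IsSimpleCollection K E) {M : C} (hM : extClosure E M) (n : ℕ) :
    FiniteDimensional K (t.total n ⟶ M) := by
  induction hM with
  | zero M hM =>
    have : Subsingleton (t.total n ⟶ M) := ⟨fun _ _ => hM.eq_of_tgt _ _⟩
    infer_instance
  | of j =>
    -- `Hom (E^(n), E j)` is `Hom (E^(0), E j)`, and this embeds into the product of the
    -- spaces `Hom (E i, E j)`
    have h (i) : FiniteDimensional K (E i ⟶ E j) := by
      by_cases hij : i = j
      · subst hij
        exact Module.Finite.of_surjective (Algebra.linearMap K (End (E i)))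
          (hE.bijective_algebraMap i).2
      · have : Subsingleton (E i ⟶ E j) :=
          ⟨fun f g => (hE.eq_zero hij f).trans (hE.eq_zero hij g).symm⟩
        infer_instance
    have h₀ : FiniteDimensional K (t.total 0 ⟶ E j) := by
      let φ : (t.total 0 ⟶ E j) →ₗ[K] (i : Fin k) → (E i ⟶ E j) :=
        LinearMap.pi fun i => Linear.leftComp K _ ((t.objZero i).inv ≫ t.incl 0 i)
      refine Module.Finite.of_injective φ fun f g hfg => t.total_hom_ext fun i => ?_
      have := congrFun hfg i
      change ((t.objZero i).inv ≫ t.incl 0 i) ≫ f =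
        ((t.objZero i).inv ≫ t.incl 0 i) ≫ g at this
      rwa [Category.assoc, Category.assoc, cancel_epi] at this
    exact Module.Finite.of_surjective (Linear.leftComp K (E j) (t.proj (Nat.zero_le n)))
      (t.isStable_simple hE j (Nat.zero_le n))
  | extension S hS _ h₁ h₃ ih₁ ih₃ =>
    have := hS.mono_f
    let φ : (t.total n ⟶ S.X₁) →ₗ[K] (t.total n ⟶ S.X₂) := Linear.rightComp K _ S.f
    let ψ : (t.total n ⟶ S.X₂) →ₗ[K] (t.total n ⟶ S.X₃) := Linear.rightComp K _ S.g
    have h : LinearMap.ker ψ = LinearMap.range φ := by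
      ext f
      exact ⟨fun hf => ⟨hS.exact.lift f hf, hS.exact.lift_f f hf⟩, fun ⟨g, hg⟩ => by
        rw [← hg]
        change (g ≫ S.f) ≫ S.g = 0
        rw [Category.assoc, S.zero, comp_zero]⟩
    have : Module.Finite K (LinearMap.ker ψ) := by
      rw [h]
      infer_instance
    have : Module.Finite K ((t.total n ⟶ S.X₂) ⧸ LinearMap.ker ψ) :=
      Module.Finite.equiv ψ.quotKerEquivRange.symm
    exact Module.Finite.of_submodule_quotient (LinearMap.ker ψ)

end UniversalExtensionTower

end Tower

/-! ### Modules over the endomorphism ring of an object -/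

section TensorHom

variable {C : Type u} [Category.{v} C] [Abelian C]

attribute [local instance] Abelian.hasFiniteBiproducts

/-- The action of an `End P`-linear map `Hom (P, M) ⟶ Hom (P, Y)` on morphisms. -/
def applyHom {P M Y : C}
    (φ : (preadditiveCoyonedaObj P).obj M ⟶ (preadditiveCoyonedaObj P).obj Y) (x : P ⟶ M) :
    P ⟶ Y := evalHom φ x

lemma applyHom_sum {P M Y : C}
    (φ : (preadditiveCoyonedaObj P).obj M ⟶ (preadditiveCoyonedaObj P).obj Y)
    {ι : Type*} [Fintype ι] (c : ι → (P ⟶ P)) (x : ι → (P ⟶ M)) :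
    applyHom φ (∑ i, c i ≫ x i) = ∑ i, c i ≫ applyHom φ (x i) := by
  refine (map_sum φ.hom (fun i => op (End.of (c i)) • x i) Finset.univ).trans ?_
  exact Finset.sum_congr rfl fun i _ => evalHom_smul φ (x i) (End.of (c i))

/-- Generators of the right `End P`-module `Hom (P, M)`, in terms of composition. -/
lemma exists_generators (P M : C)
    [Module.Finite (End P)ᵐᵒᵖ ((preadditiveCoyonedaObj P).obj M)] :
    ∃ (d : ℕ) (x : Fin d → (P ⟶ M)), ∀ y : P ⟶ M, ∃ c : Fin d → (P ⟶ P),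
      ∑ i, c i ≫ x i = y := by
  obtain ⟨d, x, hx⟩ := Module.Finite.exists_fin (R := (End P)ᵐᵒᵖ)
    (M := (preadditiveCoyonedaObj P).obj M)
  refine ⟨d, x, fun y => ?_⟩
  have h : (show (preadditiveCoyonedaObj P).obj M from y) ∈
      Submodule.span (End P)ᵐᵒᵖ (Set.range x) := hx.symm ▸ Submodule.mem_top
  obtain ⟨c, hc⟩ := (Submodule.mem_span_range_iff_exists_fun (End P)ᵐᵒᵖ).1 h
  exact ⟨fun i => (unop (c i)).asHom, hc⟩

lemma sum_comp_π_comp_ι_comp {ι : Type} [Fintype ι] {f : ι → C} {Z W : C} (z : Z ⟶ ⨁ f)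
    (g : ⨁ f ⟶ W) :
    ∑ i, (z ≫ biproduct.π f i) ≫ biproduct.ι f i ≫ g = z ≫ g := by
  have h : ∑ i, biproduct.π f i ≫ biproduct.ι f i = 𝟙 (⨁ f) := biproduct.total
  conv_rhs => rw [← Category.id_comp g, ← h, Preadditive.sum_comp, Preadditive.comp_sum]
  simp only [Category.assoc]

/-- Every nonzero morphism from `M` is nonzero on some morphism `P ⟶ M`. -/
def Generates (P M : C) : Prop :=
  ∀ ⦃Y : C⦄ (f : M ⟶ Y), (∀ x : P ⟶ M, x ≫ f = 0) → f = 0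

/-- `M` has a presentation by finite direct sums of copies of `P` as soon as `Hom (P, M)` is a
finitely generated `End P`-module and `P` generates `M` and the kernels of morphisms to `M` from
sums of copies of `P`. Then morphisms from `M` are the same as `End P`-linear maps from
`Hom (P, M)`. -/
lemma bijective_map_preadditiveCoyonedaObj {P M : C}
    [Module.Finite (End P)ᵐᵒᵖ ((preadditiveCoyonedaObj P).obj M)] (hM : Generates P M)
    (hker : ∀ (d : ℕ) (q : (⨁ fun _ : Fin d => P) ⟶ M), Generates P (kernel q)) (Y : C) :
    Function.Bijective (fun f : M ⟶ Y => (preadditiveCoyonedaObj P).map f) := by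
  constructor
  · intro f g h
    rw [← sub_eq_zero]
    refine hM _ fun x => ?_
    rw [Preadditive.comp_sub, sub_eq_zero]
    exact congrArg (fun φ => φ.hom x) h
  · intro φ
    obtain ⟨d, x, hx⟩ := exists_generators P M
    let q : (⨁ fun _ : Fin d => P) ⟶ M := biproduct.desc x
    have hq (i) : biproduct.ι (fun _ : Fin d => P) i ≫ q = x i := biproduct.ι_desc _ _
    let r : (⨁ fun _ : Fin d => P) ⟶ Y := biproduct.desc fun i => applyHom φ (x i)
    have hr (i) : biproduct.ι (fun _ : Fin d => P) i ≫ r = applyHom φ (x i) :=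
      biproduct.ι_desc _ _
    have : Epi q := Preadditive.epi_of_cancel_zero _ fun {Z} f hf => hM f fun y => by
      obtain ⟨c, rfl⟩ := hx y
      rw [Preadditive.sum_comp]
      refine Finset.sum_eq_zero fun i _ => ?_
      rw [← hq, Category.assoc, Category.assoc, hf, comp_zero, comp_zero]
    -- a relation `∑ c i ≫ x i = 0` between the generators is preserved by the linear map `φ`
    have hqr : kernel.ι q ≫ r = 0 := hker d q _ fun y => by
      have hy : (y ≫ kernel.ι q) ≫ q = 0 := by simp
      rw [← Category.assoc]
      generalize y ≫ kernel.ι q = z at hy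
      rw [← sum_comp_π_comp_ι_comp] at hy ⊢
      simp only [hq, hr] at hy ⊢
      rw [← applyHom_sum, hy]
      exact map_zero φ.hom
    refine ⟨Abelian.epiDesc q r hqr, hom_ext_evalHom fun (y : P ⟶ M) => ?_⟩
    obtain ⟨c, rfl⟩ := hx y
    change (∑ i, c i ≫ x i) ≫ Abelian.epiDesc q r hqr = applyHom φ (∑ i, c i ≫ x i)
    rw [applyHom_sum, Preadditive.sum_comp]
    refine Finset.sum_congr rfl fun i _ => ?_
    rw [← hr i, ← hq i, Category.assoc, Category.assoc, Abelian.comp_epiDesc]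

/-- Every finitely presented right module over `End P` is of the form `Hom (P, M)` for a cokernel
`M` of a morphism between sums of copies of `P`, provided that `Hom (P, -)` is exact on the
presentation of `M`. -/
lemma exists_iso_preadditiveCoyonedaObj {P : C} [IsNoetherianRing (End P)ᵐᵒᵖ]
    (h₁ : ∀ (a b : ℕ) (r : (⨁ fun _ : Fin b => P) ⟶ ⨁ fun _ : Fin a => P) (f : P ⟶ cokernel r),
      ∃ g, g ≫ cokernel.π r = f)
    (h₂ : ∀ (a b : ℕ) (r : (⨁ fun _ : Fin b => P) ⟶ ⨁ fun _ : Fin a => P)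
      (f : P ⟶ ⨁ fun _ : Fin a => P), f ≫ cokernel.π r = 0 → ∃ g, g ≫ r = f)
    (hfin : ∀ a : ℕ, Module.Finite (End P)ᵐᵒᵖ
      ((preadditiveCoyonedaObj P).obj (⨁ fun _ : Fin a => P)))
    (T : ModuleCat.{v} (End P)ᵐᵒᵖ) [Module.Finite (End P)ᵐᵒᵖ T] :
    ∃ (a b : ℕ) (r : (⨁ fun _ : Fin b => P) ⟶ ⨁ fun _ : Fin a => P),
      Nonempty (T ≅ (preadditiveCoyonedaObj P).obj (cokernel r)) := by
  obtain ⟨a, s, hs⟩ := Module.Finite.exists_fin (R := (End P)ᵐᵒᵖ) (M := T)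
  have := hfin a
  let Q := ⨁ fun _ : Fin a => P
  -- the map from the free module `Hom (P, Q)` onto `T`; the morphism `r` is given by generators of
  -- its kernel
  let Λ : (preadditiveCoyonedaObj P).obj Q →ₗ[(End P)ᵐᵒᵖ] T :=
    { toFun := fun (z : P ⟶ Q) =>
        ∑ i, op (End.of (z ≫ biproduct.π (fun _ : Fin a => P) i)) • s i
      map_add' := fun (y z : P ⟶ Q) => by
        rw [← Finset.sum_add_distrib]
        refine Finset.sum_congr rfl fun i _ => ?_
        rw [← add_smul]
        congr 1
        exact congrArg op (Preadditive.add_comp _ _ _ y z _)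
      map_smul' := fun r (z : P ⟶ Q) => by
        rw [RingHom.id_apply, Finset.smul_sum]
        refine Finset.sum_congr rfl fun i _ => ?_
        rw [smul_smul]
        congr 1
        exact congrArg op (Category.assoc (unop r).asHom z _) }
  have hΛ : Function.Surjective Λ := by
    intro y
    have hy : y ∈ Submodule.span (End P)ᵐᵒᵖ (Set.range s) := by
      rw [hs]
      exact Submodule.mem_top
    obtain ⟨c, hc⟩ := (Submodule.mem_span_range_iff_exists_fun (End P)ᵐᵒᵖ).1 hy
    refine ⟨biproduct.lift fun i => (unop (c i)).asHom, ?_⟩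
    rw [← hc]
    change ∑ i, op (End.of (biproduct.lift (fun i => (unop (c i)).asHom) ≫
      biproduct.π (fun _ : Fin a => P) i)) • s i = _
    refine Finset.sum_congr rfl fun i _ => ?_
    congr 1
    exact congrArg op (biproduct.lift_π (fun i => (unop (c i)).asHom) i)
  obtain ⟨b, l, hl⟩ := Submodule.fg_iff_exists_fin_generating_family.1
    (IsNoetherian.noetherian (LinearMap.ker Λ))
  let r : (⨁ fun _ : Fin b => P) ⟶ Q := biproduct.desc l
  have hr (i) : biproduct.ι (fun _ : Fin b => P) i ≫ r = l i := biproduct.ι_desc _ _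
  let p : (preadditiveCoyonedaObj P).obj Q →ₗ[(End P)ᵐᵒᵖ]
    (preadditiveCoyonedaObj P).obj (cokernel r) :=
      ((preadditiveCoyonedaObj P).map (cokernel.π r)).hom
  have hp : Function.Surjective p := h₁ a b r
  have hker : LinearMap.ker Λ = LinearMap.ker p := by
    apply le_antisymm
    · rw [← hl, Submodule.span_le]
      rintro _ ⟨i, rfl⟩
      change l i ≫ cokernel.π r = 0
      rw [← hr, Category.assoc, cokernel.condition, comp_zero]
    · intro z hz
      obtain ⟨y, rfl⟩ := h₂ a b r z hz
      rw [← sum_comp_π_comp_ι_comp]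
      refine sum_mem fun i _ => ?_
      rw [hr]
      exact Submodule.smul_mem _ (op (End.of (y ≫ biproduct.π (fun _ : Fin b => P) i)))
        (hl ▸ Submodule.subset_span ⟨i, rfl⟩ : l i ∈ LinearMap.ker Λ)
  exact ⟨a, b, r, ⟨((Λ.quotKerEquivOfSurjective hΛ).symm.trans
    ((Submodule.quotEquivOfEq _ _ hker).trans (p.quotKerEquivOfSurjective hp))).toModuleIso⟩⟩

end TensorHom

/-! ### Finite dimensional modules over the truncations of the hull -/

section

variable {C : Type u} [Category.{v} C] [Abelian C] [HasCoproducts.{v} C]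

/-- The counit `Hom (P, M) ⊗ P ⟶ M` is an isomorphism as soon as morphisms from `M` are the same as
`End P`-linear maps from `Hom (P, M)`. -/
lemma isIso_tensorAdjunction_counit {P M : C}
    (h : ∀ Y, Function.Bijective (fun f : M ⟶ Y => (preadditiveCoyonedaObj P).map f)) :
    IsIso ((tensorAdjunction P).counit.app M) := by
  apply isIso_of_coyoneda_map_bijective
  intro Y
  have e : ((tensorAdjunction P).homEquiv _ Y) ∘
      (fun f : M ⟶ Y => (tensorAdjunction P).counit.app M ≫ f) =
      fun f : M ⟶ Y => (preadditiveCoyonedaObj P).map f := by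
    funext f
    change (tensorAdjunction P).homEquiv _ Y ((tensorAdjunction P).counit.app M ≫ f) = _
    rw [Adjunction.homEquiv_unit, Functor.map_comp, Adjunction.right_triangle_components_assoc]
  have h' := h Y
  rw [← e] at h'
  exact (Equiv.comp_bijective _ _).1 h'

/-- The unit at a module `Hom (P, M)` is inverse to the image of the counit at `M`. -/
lemma isIso_tensorAdjunction_unit {P M : C} {T : ModuleCat.{v} (End P)ᵐᵒᵖ}
    (e : T ≅ (preadditiveCoyonedaObj P).obj M) [IsIso ((tensorAdjunction P).counit.app M)] :
    IsIso ((tensorAdjunction P).unit.app T) := by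
  have h₁ := (tensorAdjunction P).right_triangle_components M
  have : IsIso ((tensorAdjunction P).unit.app ((preadditiveCoyonedaObj P).obj M)) := by
    have : IsIso ((tensorAdjunction P).unit.app ((preadditiveCoyonedaObj P).obj M) ≫
        (preadditiveCoyonedaObj P).map ((tensorAdjunction P).counit.app M)) := by
      rw [h₁]; infer_instance
    exact IsIso.of_isIso_comp_right _
      ((preadditiveCoyonedaObj P).map ((tensorAdjunction P).counit.app M))
  exact (NatTrans.isIso_app_iff_of_iso _ e).2 this

/-- A left adjoint is bijective on morphisms to an object at which the unit is an isomorphism. -/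
lemma bijective_tensorFunctor_map {P : C} (T T' : ModuleCat.{v} (End P)ᵐᵒᵖ)
    [IsIso ((tensorAdjunction P).unit.app T')] :
    Function.Bijective (fun f : T ⟶ T' => (tensorFunctor P).map f) := by
  have e : ((tensorAdjunction P).homEquiv T _) ∘
      (fun f : T ⟶ T' => (tensorFunctor P).map f) =
      fun f : T ⟶ T' => f ≫ (tensorAdjunction P).unit.app T' := by
    funext f
    change (tensorAdjunction P).homEquiv T _ ((tensorFunctor P).map f) = _
    rw [Adjunction.homEquiv_unit, Adjunction.unit_naturality]
  apply (Equiv.comp_bijective _ ((tensorAdjunction P).homEquiv T _)).1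
  rw [e]
  exact ((asIso ((tensorAdjunction P).unit.app T')).homToEquiv).bijective

end

namespace UniversalExtensionTower

attribute [local instance] Abelian.hasFiniteBiproducts

variable {K : Type*} [Field K] {C : Type u} [Category.{v} C] [Abelian C] [Linear K C] [HasExt.{w} C]

variable {k : ℕ} {E : Fin k → C} (t : UniversalExtensionTower.{w} K E)

lemma IsStable.of_mono {n : ℕ} {M N : C} (f : M ⟶ N) [Mono f] (hN : t.IsStable n N) :
    t.IsStable n M :=
  IsStable.X₁ (S := ShortComplex.mk f (cokernel.π f) (cokernel.condition f))
    { exact := ShortComplex.exact_cokernel f } hN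

lemma isStable_biproduct {n d : ℕ} {M : C} (hM : t.IsStable n M) :
    t.IsStable n (⨁ fun _ : Fin d => M) :=
  IsStable.of_sum (biproduct.π fun _ : Fin d => M) (biproduct.ι fun _ : Fin d => M)
    biproduct.total fun _ => hM

lemma exists_lift_of_epi (hE : IsSimpleCollection K E) {n : ℕ} {M N : C} (hM : extClosure E M)
    (hN : extClosure E N) (hs : t.IsStable n M) (g : M ⟶ N) [Epi g] (f : t.total n ⟶ N) :
    ∃ l, l ≫ g = f :=
  t.exists_lift (S := ShortComplex.mk (kernel.ι g) g (kernel.condition g))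
    { exact := ShortComplex.exact_kernel g } (hE.extClosure_kernel_cokernel hM hN g).1 hs f

lemma isStable_of_epi (hE : IsSimpleCollection K E) {n : ℕ} {M N : C} (hM : extClosure E M)
    (hN : extClosure E N) (hs : t.IsStable n M) (g : M ⟶ N) [Epi g] : t.IsStable n N :=
  t.isStable_X₃ (S := ShortComplex.mk (kernel.ι g) g (kernel.condition g))
    { exact := ShortComplex.exact_kernel g } (hE.extClosure_kernel_cokernel hM hN g).1 hs

variable (hE : IsSimpleCollection K E)
include hE

lemma module_finite_hom {M : C} (hM : extClosure E M) (n : ℕ) :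
    Module.Finite (t.R n)ᵐᵒᵖ ((preadditiveCoyonedaObj (t.total n)).obj M) := by
  have := t.finiteDimensional_hom hE hM n
  obtain ⟨d, x, hx⟩ := Module.Finite.exists_fin (R := K) (M := t.total n ⟶ M)
  refine ⟨Submodule.fg_iff_exists_fin_generating_family.2 ⟨d, x, eq_top_iff.2 ?_⟩⟩
  rintro (y : t.total n ⟶ M) -
  have hy : y ∈ Submodule.span K (Set.range x) := by rw [hx]; exact Submodule.mem_top
  obtain ⟨c, rfl⟩ := (Submodule.mem_span_range_iff_exists_fun K).1 hy
  refine (Submodule.mem_span_range_iff_exists_fun (t.R n)ᵐᵒᵖ).2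
    ⟨fun i => op (End.of (c i • 𝟙 (t.total n))), Finset.sum_congr rfl fun i _ => ?_⟩
  change (c i • 𝟙 (t.total n)) ≫ x i = c i • x i
  rw [Linear.smul_comp, Category.id_comp]

lemma isNoetherianRing_R (n : ℕ) : IsNoetherianRing (t.R n)ᵐᵒᵖ := by
  have : Module.Finite K (t.R n) := t.finiteDimensional_hom hE (t.extClosure_total n) n
  exact IsNoetherianRing.of_finite K _

lemma finDim_hom {M : C} (hM : extClosure E M) (n : ℕ) :
    finDim.{v} K (t.R n)ᵐᵒᵖ ((preadditiveCoyonedaObj (t.total n)).obj M) := by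
  have := t.finiteDimensional_hom hE hM n
  let e : (t.total n ⟶ M) →ₗ[K] (ModuleCat.restrictScalars (algebraMap K (t.R n)ᵐᵒᵖ)).obj
      ((preadditiveCoyonedaObj (t.total n)).obj M) :=
    { toFun := fun f => f
      map_add' := fun _ _ => rfl
      map_smul' := fun c f => by
        change c • f = (c • 𝟙 (t.total n)) ≫ f
        rw [Linear.smul_comp, Category.id_comp] }
  exact Module.Finite.of_surjective e fun f => ⟨f, rfl⟩

omit hE in
lemma module_finite_of_finDim {n : ℕ} {T : ModuleCat.{v} (t.R n)ᵐᵒᵖ}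
    (hT : finDim.{v} K (t.R n)ᵐᵒᵖ T) : Module.Finite (t.R n)ᵐᵒᵖ T := by
  have : FiniteDimensional K ((ModuleCat.restrictScalars (algebraMap K (t.R n)ᵐᵒᵖ)).obj T) := hT
  obtain ⟨d, x, hx⟩ := Module.Finite.exists_fin (R := K)
    (M := (ModuleCat.restrictScalars (algebraMap K (t.R n)ᵐᵒᵖ)).obj T)
  refine ⟨Submodule.fg_iff_exists_fin_generating_family.2 ⟨d, x, eq_top_iff.2 ?_⟩⟩
  rintro y -
  have hy : (show (ModuleCat.restrictScalars (algebraMap K (t.R n)ᵐᵒᵖ)).obj T from y) ∈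
    Submodule.span K (Set.range x) := by rw [hx]; exact Submodule.mem_top
  obtain ⟨c, hc⟩ := (Submodule.mem_span_range_iff_exists_fun K).1 hy
  exact (Submodule.mem_span_range_iff_exists_fun (t.R n)ᵐᵒᵖ).2
    ⟨fun i => algebraMap K _ (c i), hc⟩

/-- An object of the extension closure is recovered from its `R^(n)`-module of morphisms from
`E^(n)` if it is `n`-stable. -/
lemma bijective_map {M : C} (hM : extClosure E M) {n : ℕ} (hs : t.IsStable n M) (Y : C) :
    Function.Bijective (fun f : M ⟶ Y => (preadditiveCoyonedaObj (t.total n)).map f) := by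
  have := t.module_finite_hom hE hM n
  refine bijective_map_preadditiveCoyonedaObj
    (fun _ f hf => t.eq_zero_of_forall hM hs f hf) (fun d q _ f hf => ?_) Y
  exact t.eq_zero_of_forall
    (hE.extClosure_kernel_cokernel (extClosure_biproduct _ fun _ => t.extClosure_total n) hM q).1
    (IsStable.of_mono t (kernel.ι q) (t.isStable_biproduct (t.isStable_total hE n))) f hf

/-- Every finite dimensional right `R^(n)`-module is `Hom (E^(n), M)` for some `n`-stable `M` in the
extension closure. -/
lemma exists_iso_hom {n : ℕ} {T : ModuleCat.{v} (t.R n)ᵐᵒᵖ} (hT : finDim.{v} K (t.R n)ᵐᵒᵖ T) :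
    ∃ M, extClosure E M ∧ t.IsStable n M ∧
      Nonempty (T ≅ (preadditiveCoyonedaObj (t.total n)).obj M) := by
  have := t.isNoetherianRing_R hE n
  have := t.module_finite_of_finDim hT
  have hsum (a : ℕ) : extClosure E (⨁ fun _ : Fin a => t.total n) :=
    extClosure_biproduct _ fun _ => t.extClosure_total n
  have hst (a : ℕ) : t.IsStable n (⨁ fun _ : Fin a => t.total n) :=
    t.isStable_biproduct (t.isStable_total hE n)
  have hcok {a b : ℕ} (r : (⨁ fun _ : Fin b => t.total n) ⟶ ⨁ fun _ : Fin a => t.total n) :=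
    (hE.extClosure_kernel_cokernel (hsum b) (hsum a) r).2
  obtain ⟨a, b, r, e⟩ := exists_iso_preadditiveCoyonedaObj (P := t.total n)
    (fun a b r f => t.exists_lift_of_epi hE (hsum a) (hcok r) (hst a) (cokernel.π r) f)
    (fun a b r f hf => by
      have him : extClosure E (Abelian.image r) :=
        (hE.extClosure_kernel_cokernel (hsum a) (hcok r) (cokernel.π r)).1
      obtain ⟨g, hg⟩ := t.exists_lift_of_epi hE (hsum b) him (hst b)
        (Abelian.factorThruImage r) (kernel.lift _ f hf)
      refine ⟨g, ?_⟩
      rw [← Abelian.image.fac r, ← Category.assoc, hg]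
      exact kernel.lift_ι _ _ _)
    (fun a => t.module_finite_hom hE (hsum a) n) T
  exact ⟨_, hcok r, t.isStable_of_epi hE (hsum a) (hcok r) (hst a) (cokernel.π r), e⟩

variable [HasCoproducts.{v} C]

lemma isIso_counit {M : C} (hM : extClosure E M) {n : ℕ} (hs : t.IsStable n M) :
    IsIso ((tensorAdjunction (t.total n)).counit.app M) :=
  isIso_tensorAdjunction_counit (t.bijective_map hE hM hs)

lemma isIso_unit {n : ℕ} {T : ModuleCat.{v} (t.R n)ᵐᵒᵖ} (hT : finDim.{v} K (t.R n)ᵐᵒᵖ T) :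
    IsIso ((tensorAdjunction (t.total n)).unit.app T) := by
  obtain ⟨M, hM, hs, ⟨e⟩⟩ := t.exists_iso_hom hE hT
  have := t.isIso_counit hE hM hs
  exact isIso_tensorAdjunction_unit e

/-- `T ⊗ E^(n)` lies in the extension closure and is `n`-stable. -/
lemma extClosure_tensorObj_and_isStable {n : ℕ} {T : ModuleCat.{v} (t.R n)ᵐᵒᵖ}
    (hT : finDim.{v} K (t.R n)ᵐᵒᵖ T) :
    extClosure E (tensorObj (t.total n) T) ∧ t.IsStable n (tensorObj (t.total n) T) := by
  obtain ⟨M, hM, hs, ⟨e⟩⟩ := t.exists_iso_hom hE hT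
  have := t.isIso_counit hE hM hs
  let i : tensorObj (t.total n) T ≅ M := (tensorFunctor (t.total n)).mapIso e ≪≫
    asIso ((tensorAdjunction (t.total n)).counit.app M)
  exact ⟨extClosure_of_iso i.symm hM, IsStable.of_mono t i.hom hs⟩

end UniversalExtensionTower

/-! ### The functor defined by the tensor products -/

section

variable {C : Type u} [Category.{v} C] [Abelian C] [HasCoproducts.{v} C]

/-- Two morphisms from `T ⊗ G` agree if they agree on the `x ⊗ e`. -/
lemma tensorObj_hom_ext {G : C} {T : ModuleCat.{v} (End G)ᵐᵒᵖ} {Y : C} {f g : tensorObj G T ⟶ Y}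
    (h : ∀ x, pureTensor G T x ≫ f = pureTensor G T x ≫ g) : f = g :=
  (tensorHomEquiv G T Y).injective (hom_ext_evalHom h)

end

namespace UniversalExtensionTower

variable {K : Type*} [Field K] {C : Type u} [Category.{v} C] [Abelian C] [Linear K C] [HasExt.{w} C]

variable {k : ℕ} {E : Fin k → C} (t : UniversalExtensionTower.{w} K E)

lemma hull_comp_proj (φ : t.hull) {m n : ℕ} (h : m ≤ n) :
    End.asHom (φ.1 n) ≫ t.proj h = t.proj h ≫ End.asHom (φ.1 m) := by
  induction n, h using Nat.le_induction with
  | base => rw [proj_self, Category.comp_id, Category.id_comp]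
  | succ n h ih =>
    rw [← t.proj_proj h (Nat.le_add_right n 1), proj_succ, Category.assoc, ← ih,
      ← Category.assoc, φ.2 n, Category.assoc]

section

variable (hE : IsSimpleCollection K E)
include hE

lemma exists_endLift {m n : ℕ} (h : m ≤ n) (a : t.total m ⟶ t.total m) :
    ∃ b : t.total n ⟶ t.total n, b ≫ t.proj h = t.proj h ≫ a :=
  t.exists_lift_of_epi hE (t.extClosure_total n) (t.extClosure_total m) (t.isStable_total hE n)
    (t.proj h) (t.proj h ≫ a)

/-- A lift of an endomorphism of `E^(n)` along all projections `E^(n+j) ⟶ E^(n)`. -/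
def endLiftSeq {n : ℕ} (a : t.total n ⟶ t.total n) : ∀ j : ℕ, t.total (n + j) ⟶ t.total (n + j)
  | 0 => a
  | j + 1 => (t.exists_endLift hE (Nat.le_add_right (n + j) 1) (endLiftSeq a j)).choose

lemma endLiftSeq_succ {n : ℕ} (a : t.total n ⟶ t.total n) (j : ℕ) :
    t.endLiftSeq hE a (j + 1) ≫ t.proj (Nat.le_add_right (n + j) 1) =
      t.proj (Nat.le_add_right (n + j) 1) ≫ t.endLiftSeq hE a j :=
  (t.exists_endLift hE (Nat.le_add_right (n + j) 1) (t.endLiftSeq hE a j)).choose_spec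

lemma endLiftSeq_comp_proj {n : ℕ} (a : t.total n ⟶ t.total n) (j : ℕ) :
    t.endLiftSeq hE a j ≫ t.proj (Nat.le_add_right n j) = t.proj (Nat.le_add_right n j) ≫ a := by
  induction j with
  | zero =>
    change a ≫ t.proj (le_refl n) = t.proj (le_refl n) ≫ a
    rw [proj_self, Category.comp_id, Category.id_comp]
  | succ j ih =>
    rw [← t.proj_proj (Nat.le_add_right n j) (Nat.le_add_right (n + j) 1), ← Category.assoc,
      endLiftSeq_succ, Category.assoc, ih, Category.assoc]

/-- The projection of the hull to `R^(n)` is surjective: endomorphisms of `E^(n)` lift to all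
`E^(m)` with `m ≥ n`, and they descend to all `E^(m)` with `m ≤ n`, as these are `m`-stable. -/
lemma hullProj_surjective (n : ℕ) : Function.Surjective (t.hullProj n) := by
  intro a
  have h (m : ℕ) := t.isStable_total hE m (Nat.le_add_left m n)
    (t.endLiftSeq hE (End.asHom a) m ≫ t.proj (Nat.le_add_left m n))
  -- `ψ m` is obtained from a lift of `a` to `E^(n+m)`, which descends to `E^(m)`
  choose ψ hψ using h
  refine ⟨⟨fun m => End.of (ψ m), fun m => ?_⟩, ?_⟩
  · change ψ (m + 1) ≫ t.totalπ m = t.totalπ m ≫ ψ m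
    rw [← cancel_epi (t.proj (Nat.le_add_left (m + 1) n)), ← proj_succ, ← Category.assoc, hψ,
      proj_proj_assoc, Category.assoc, proj_proj]
    change _ ≫ t.proj ((Nat.le_add_left m n).trans (Nat.le_add_right (n + m) 1)) =
      t.proj ((Nat.le_add_left m n).trans (Nat.le_add_right (n + m) 1)) ≫ ψ m
    rw [← t.proj_proj (Nat.le_add_left m n) (Nat.le_add_right (n + m) 1), ← Category.assoc,
      endLiftSeq_succ, Category.assoc, ← hψ, Category.assoc]
  · change ψ n = End.asHom a
    rw [← cancel_epi (t.proj (Nat.le_add_left n n)), hψ]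
    exact t.endLiftSeq_comp_proj hE (End.asHom a) n

end

section Restrict

variable {t} {l m n : ℕ} {T : ModuleCat.{v} (t.R n)ᵐᵒᵖ} {U : ModuleCat.{v} (t.R m)ᵐᵒᵖ}
  {V : ModuleCat.{v} (t.R l)ᵐᵒᵖ}

/-- The underlying map of a morphism of modules over the hull. -/
def applyRestrict (f : (t.restrict n).obj T ⟶ (t.restrict m).obj U) (x : T) : U := f.hom x

lemma applyRestrict_add (f : (t.restrict n).obj T ⟶ (t.restrict m).obj U) (x y : T) :
    applyRestrict f (x + y) = applyRestrict f x + applyRestrict f y := f.hom.map_add x y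

lemma applyRestrict_zero (f : (t.restrict n).obj T ⟶ (t.restrict m).obj U) :
    applyRestrict f 0 = 0 := f.hom.map_zero

lemma applyRestrict_smul (f : (t.restrict n).obj T ⟶ (t.restrict m).obj U) (φ : t.hull) (x : T) :
    applyRestrict f (op (φ.1 n) • x) = op (φ.1 m) • applyRestrict f x := f.hom.map_smul (op φ) x

variable [HasCoproducts.{v} C]

/-- `g : T ⊗ E^(n) ⟶ U ⊗ E^(m)` is induced by the map `f : T ⟶ U` of modules over the hull, that
is, it maps `x ⊗ p e` to `f x ⊗ p' e` for the projections `p` and `p'` of any `E^(N)` to `E^(n)`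
and `E^(m)`. -/
def IsInduced (f : (t.restrict n).obj T ⟶ (t.restrict m).obj U)
    (g : tensorObj (t.total n) T ⟶ tensorObj (t.total m) U) : Prop :=
  ∀ ⦃N : ℕ⦄ (hn : n ≤ N) (hm : m ≤ N) (x : T),
    t.proj hn ≫ pureTensor (t.total n) T x ≫ g =
      t.proj hm ≫ pureTensor (t.total m) U (applyRestrict f x)

/-- It suffices to check the condition for one `N`. -/
lemma IsInduced.mk {f : (t.restrict n).obj T ⟶ (t.restrict m).obj U}
    {g : tensorObj (t.total n) T ⟶ tensorObj (t.total m) U} {N : ℕ} (hn : n ≤ N) (hm : m ≤ N)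
    (h : ∀ x : T, t.proj hn ≫ pureTensor (t.total n) T x ≫ g =
      t.proj hm ≫ pureTensor (t.total m) U (applyRestrict f x)) : IsInduced f g := by
  intro N' hn' hm' x
  rw [← cancel_epi (t.proj (le_max_left N' N)), proj_proj_assoc, proj_proj_assoc]
  have h' := t.proj (le_max_right N' N) ≫= h x
  rwa [proj_proj_assoc, proj_proj_assoc] at h'

lemma IsInduced.eq {f f' : (t.restrict n).obj T ⟶ (t.restrict m).obj U}
    {g g' : tensorObj (t.total n) T ⟶ tensorObj (t.total m) U} (h : IsInduced f g)
    (h' : IsInduced f' g') (hf : f = f') : g = g' := by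
  subst hf
  refine tensorObj_hom_ext fun x => ?_
  rw [← cancel_epi (t.proj (le_max_left n m)), h _ (le_max_right n m), h' _ (le_max_right n m)]

lemma IsInduced.id (T : ModuleCat.{v} (t.R n)ᵐᵒᵖ) :
    IsInduced (𝟙 ((t.restrict n).obj T)) (𝟙 (tensorObj (t.total n) T)) := by
  intro N hn hm x
  rw [Category.comp_id]
  rfl

lemma IsInduced.comp {f : (t.restrict n).obj T ⟶ (t.restrict m).obj U}
    {f' : (t.restrict m).obj U ⟶ (t.restrict l).obj V}
    {g : tensorObj (t.total n) T ⟶ tensorObj (t.total m) U}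
    {g' : tensorObj (t.total m) U ⟶ tensorObj (t.total l) V} (h : IsInduced f g)
    (h' : IsInduced f' g') : IsInduced (f ≫ f') (g ≫ g') := by
  refine IsInduced.mk ((le_max_left n m).trans (le_max_left _ l)) (le_max_right (max n m) l)
    fun x => ?_
  have h₁ := h ((le_max_left n m).trans (le_max_left _ l))
    ((le_max_right n m).trans (le_max_left _ l)) x =≫ g'
  rw [Category.assoc, Category.assoc, Category.assoc] at h₁
  rw [h₁, h' _ (le_max_right (max n m) l)]
  rfl

lemma IsInduced.map {T T' : ModuleCat.{v} (t.R n)ᵐᵒᵖ} (f : T ⟶ T') :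
    IsInduced ((t.restrict n).map f) ((tensorFunctor (t.total n)).map f) := by
  intro N hn hm x
  exact congrArg (fun g => t.proj hn ≫ g) (pureTensor_map (t.total n) f x)

/-- The morphism `x ⊗ e ↦ f x ⊗ e` is well defined on the `E^(N)`-level since the kernel of
`E^(N) ⟶ E^(n)` is generated by `E^(N)`, and morphisms from `E^(N)` to it are values of elements of
the hull that act trivially on `T`. -/
lemma exists_pureTensor_desc (hE : IsSimpleCollection K E)
    (f : (t.restrict n).obj T ⟶ (t.restrict m).obj U) {N : ℕ} (hn : n ≤ N) (hm : m ≤ N) (x : T) :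
    ∃ z : t.total n ⟶ tensorObj (t.total m) U,
      t.proj hn ≫ z = t.proj hm ≫ pureTensor (t.total m) U (applyRestrict f x) := by
  refine ⟨Abelian.epiDesc (t.proj hn) _ ?_, Abelian.comp_epiDesc _ _ _⟩
  refine t.eq_zero_of_forall (n := N) (hE.extClosure_kernel_cokernel (t.extClosure_total N)
    (t.extClosure_total n) (t.proj hn)).1 (IsStable.of_mono t (kernel.ι (t.proj hn))
    (t.isStable_total hE N)) _ fun y => ?_
  obtain ⟨φ, hφ⟩ := t.hullProj_surjective hE N (End.of (y ≫ kernel.ι (t.proj hn)))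
  have hφN : y ≫ kernel.ι (t.proj hn) = End.asHom (φ.1 N) := hφ.symm
  have hφn : φ.1 n = 0 := by
    change End.asHom (φ.1 n) = 0
    rw [← cancel_epi (t.proj hn), ← hull_comp_proj, ← hφN, Category.assoc, kernel.condition,
      comp_zero, comp_zero]
  have h0 : op (φ.1 m) • applyRestrict f x = 0 := by
    rw [← applyRestrict_smul, hφn, MulOpposite.op_zero, zero_smul, applyRestrict_zero]
  have hz : pureTensor (t.total m) U 0 = 0 := by
    have := pureTensor_add (t.total m) U 0 0
    rwa [add_zero, left_eq_add] at this
  rw [← Category.assoc, hφN, ← Category.assoc, hull_comp_proj, Category.assoc]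
  have h := pureTensor_smul (t.total m) U (applyRestrict f x) (op (φ.1 m))
  rw [h0, hz] at h
  rw [← unop_op (φ.1 m), ← h, comp_zero]

lemma exists_isInduced (hE : IsSimpleCollection K E)
    (f : (t.restrict n).obj T ⟶ (t.restrict m).obj U) : ∃ g, IsInduced f g := by
  have hn := le_max_left n m
  have hm := le_max_right n m
  choose z hz using fun x => exists_pureTensor_desc hE f hn hm x
  let g : T ⟶ (preadditiveCoyonedaObj (t.total n)).obj (tensorObj (t.total m) U) :=
    ModuleCat.ofHom
      { toFun := z
        map_add' := fun x y => by
          rw [← cancel_epi (t.proj hn), hz, applyRestrict_add, pureTensor_add, Preadditive.comp_add,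
            Preadditive.comp_add, hz, hz]
        map_smul' := fun r x => by
          change z (r • x) = End.asHom (unop r) ≫ z x
          obtain ⟨φ, hφ⟩ := t.hullProj_surjective hE n (unop r)
          have hr : unop r = φ.1 n := hφ.symm
          have hr' : r = op (φ.1 n) := by rw [← hr, op_unop]
          rw [hr, hr', ← cancel_epi (t.proj hn), hz, applyRestrict_smul, pureTensor_smul, unop_op,
            ← Category.assoc, ← hull_comp_proj, Category.assoc, ← hz, ← Category.assoc,
            hull_comp_proj, Category.assoc] }
  refine ⟨(tensorHomEquiv _ _ _).symm g, IsInduced.mk hn hm fun x => ?_⟩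
  rw [← hz]
  congr 1
  exact congrArg (fun a => evalHom a x) ((tensorHomEquiv _ _ _).apply_symm_apply g)

/-- The morphism `T ⊗ E^(n) ⟶ U ⊗ E^(m)` induced by a map `T ⟶ U` of modules over the hull. -/
def inducedMap (hE : IsSimpleCollection K E) (f : (t.restrict n).obj T ⟶ (t.restrict m).obj U) :
    tensorObj (t.total n) T ⟶ tensorObj (t.total m) U := (exists_isInduced hE f).choose

lemma isInduced_inducedMap (hE : IsSimpleCollection K E)
    (f : (t.restrict n).obj T ⟶ (t.restrict m).obj U) : IsInduced f (inducedMap hE f) :=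
  (exists_isInduced hE f).choose_spec

/-- The isomorphism `T ⊗ E^(n) ≅ U ⊗ E^(m)` induced by an isomorphism `T ≅ U` of modules over the
hull. -/
def inducedIso (hE : IsSimpleCollection K E) (e : (t.restrict n).obj T ≅ (t.restrict m).obj U) :
    tensorObj (t.total n) T ≅ tensorObj (t.total m) U where
  hom := inducedMap hE e.hom
  inv := inducedMap hE e.inv
  hom_inv_id := by
    have h := (isInduced_inducedMap hE e.hom).comp (isInduced_inducedMap hE e.inv)
    exact h.eq (.id T) e.hom_inv_id
  inv_hom_id := by
    have h := (isInduced_inducedMap hE e.inv).comp (isInduced_inducedMap hE e.hom)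
    exact h.eq (.id U) e.inv_hom_id

end Restrict

section Phi

variable [HasCoproducts.{v} C] (hE : IsSimpleCollection K E) {A : ObjectProperty C}
  (hA : ∀ M, extensionClosure A E M ↔ extClosure E M)

variable {t}

/-- A number `n` such that the nilpotent module `T` comes from an `R^(n)`-module. -/
def level (T : t.modNil) : ℕ := T.property.choose

/-- An `R^(n)`-module from which the nilpotent module `T` comes. -/
def model (T : t.modNil) : t.modR (level T) := T.property.choose_spec.choose

/-- The identification of `T` with its model. -/
def modelIso (T : t.modNil) : (t.restrict (level T)).obj (model T).obj ≅ T.obj :=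
  T.property.choose_spec.choose_spec.some

/-- A map of nilpotent modules as a map between their models. -/
def modelMap {T U : t.modNil} (f : T ⟶ U) :
    (t.restrict (level T)).obj (model T).obj ⟶ (t.restrict (level U)).obj (model U).obj :=
  (modelIso T).hom ≫ f.hom ≫ (modelIso U).inv

include hE hA in
lemma extensionClosure_tensorObj {n : ℕ} (T : t.modR n) :
    extensionClosure A E (tensorObj (t.total n) T.obj) :=
  (hA _).2 (t.extClosure_tensorObj_and_isStable hE T.property).1

variable (t) in
/-- The functor `Φ`: the tensor product of a model of the module with the corresponding `E^(n)`. -/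
def phiFunctor : t.modNil ⥤ (extensionClosure A E).FullSubcategory where
  obj T := ⟨tensorObj (t.total (level T)) (model T).obj, extensionClosure_tensorObj hE hA (model T)⟩
  map f := ObjectProperty.homMk (inducedMap hE (modelMap f))
  map_id T := by
    apply ObjectProperty.hom_ext
    refine (isInduced_inducedMap hE _).eq (.id _) ?_
    change (modelIso T).hom ≫ 𝟙 _ ≫ (modelIso T).inv = 𝟙 _
    rw [Category.id_comp, Iso.hom_inv_id]
  map_comp f g := by
    apply ObjectProperty.hom_ext
    refine (isInduced_inducedMap hE _).eq
      ((isInduced_inducedMap hE (modelMap f)).comp (isInduced_inducedMap hE (modelMap g))) ?_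
    simp [modelMap]

variable (t) in
/-- The isomorphism `Φ(T) ≅ T ⊗ E^(n)`, natural in the `R^(n)`-module `T`. -/
def phiIso (n : ℕ) : t.toModNil n ⋙ t.phiFunctor hE hA ⋙ (extensionClosure A E).ι ≅
    (finDim.{v} K (t.R n)ᵐᵒᵖ).ι ⋙ tensorFunctor (t.total n) :=
  NatIso.ofComponents (fun T => inducedIso hE (modelIso ((t.toModNil n).obj T))) (by
    intro T U f
    have h₁ := (isInduced_inducedMap hE (modelMap ((t.toModNil n).map f))).comp
      (isInduced_inducedMap hE (modelIso ((t.toModNil n).obj U)).hom)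
    have h₂ := (isInduced_inducedMap hE (modelIso ((t.toModNil n).obj T)).hom).comp
      (IsInduced.map f.hom)
    have h : modelMap ((t.toModNil n).map f) ≫ (modelIso ((t.toModNil n).obj U)).hom =
        (modelIso ((t.toModNil n).obj T)).hom ≫ (t.restrict n).map f.hom := by
      simp only [modelMap, Category.assoc, Iso.inv_hom_id]
      exact congrArg _ (Category.comp_id _)
    exact h₁.eq h₂ h)

variable (t) in
/-- The functor `Φ` with its defining isomorphisms. -/
def phi : t.Phi A where
  functor := t.phiFunctor hE hA
  iso n := t.phiIso hE hA n
  compatible n T' T f x := by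
    have h : (modelIso ((t.toModNil (n + 1)).obj T')).inv ≫ modelMap f =
        f.hom ≫ (modelIso ((t.toModNil n).obj T)).inv := by
      simp only [modelMap, Iso.inv_hom_id_assoc]
    have h₁ := (isInduced_inducedMap hE (modelIso ((t.toModNil (n + 1)).obj T')).inv).comp
      (isInduced_inducedMap hE (modelMap f))
    have h₂ := isInduced_inducedMap hE (T := T'.obj) (U := T.obj) f.hom
    have h₃ := h₁.eq (h₂.comp (isInduced_inducedMap hE (modelIso ((t.toModNil n).obj T)).inv)) h
    have h₄ := h₂ (le_refl (n + 1)) (Nat.le_add_right n 1) x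
    rw [proj_self, Category.id_comp, proj_succ] at h₄
    have h₅ := pureTensor (t.total (n + 1)) T'.obj x ≫= h₃
    rw [← Category.assoc _ (inducedMap hE f.hom), h₄, Category.assoc] at h₅
    exact h₅

end Phi

end UniversalExtensionTower

/-! ### The equivalence of categories -/

/-- Whether a functor is bijective on morphisms only depends on the objects up to isomorphism. -/
lemma bijective_map_of_iso {A B : Type*} [Category* A] [Category* B] (F : A ⥤ B) {X Y X' Y' : A}
    (e : X ≅ X') (e' : Y ≅ Y') (h : Function.Bijective (F.map : (X ⟶ Y) → _)) :
    Function.Bijective (F.map : (X' ⟶ Y') → _) := by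
  have h' : (F.map : (X' ⟶ Y') → _) ∘ e.homCongr e' =
      (F.mapIso e).homCongr (F.mapIso e') ∘ F.map := by
    funext f
    exact F.map_homCongr e e' f
  rw [← Equiv.bijective_comp (e.homCongr e'), h']
  exact ((F.mapIso e).homCongr (F.mapIso e')).bijective.comp h

namespace UniversalExtensionTower

variable {K : Type*} [Field K] {C : Type u} [Category.{v} C] [Abelian C] [Linear K C] [HasExt.{w} C]

variable {k : ℕ} {E : Fin k → C} (t : UniversalExtensionTower.{w} K E)
  (hE : IsSimpleCollection K E)

include hE in
lemma exists_transition {m n : ℕ} (h : m ≤ n) (a : t.R n) :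
    ∃ b : t.R m, t.proj h ≫ End.asHom b = End.asHom a ≫ t.proj h :=
  t.isStable_total hE m h (End.asHom a ≫ t.proj h)

/-- The transition map `R^(n) ⟶ R^(m)`. -/
def transition {m n : ℕ} (h : m ≤ n) : t.R n →ₐ[K] t.R m where
  toFun a := (t.exists_transition hE h a).choose
  map_one' := by
    change End.asHom (t.exists_transition hE h 1).choose = 𝟙 _
    rw [← cancel_epi (t.proj h), (t.exists_transition hE h 1).choose_spec, Category.comp_id]
    exact Category.id_comp _
  map_mul' a b := by
    change End.asHom (t.exists_transition hE h (a * b)).choose =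
      End.asHom (t.exists_transition hE h b).choose ≫ End.asHom (t.exists_transition hE h a).choose
    rw [← cancel_epi (t.proj h), (t.exists_transition hE h (a * b)).choose_spec, ← Category.assoc,
      (t.exists_transition hE h b).choose_spec, Category.assoc,
      (t.exists_transition hE h a).choose_spec]
    exact Category.assoc _ _ _
  map_zero' := by
    change End.asHom (t.exists_transition hE h 0).choose = 0
    rw [← cancel_epi (t.proj h), (t.exists_transition hE h 0).choose_spec, comp_zero]
    exact zero_comp
  map_add' a b := by
    change End.asHom (t.exists_transition hE h (a + b)).choose =
      End.asHom (t.exists_transition hE h a).choose + End.asHom (t.exists_transition hE h b).choose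
    rw [← cancel_epi (t.proj h), (t.exists_transition hE h (a + b)).choose_spec,
      Preadditive.comp_add, (t.exists_transition hE h b).choose_spec,
      (t.exists_transition hE h a).choose_spec]
    exact Preadditive.add_comp _ _ _ _ _ _
  commutes' c := by
    change End.asHom (t.exists_transition hE h (algebraMap K _ c)).choose = c • 𝟙 (t.total m)
    rw [← cancel_epi (t.proj h), (t.exists_transition hE h _).choose_spec, Linear.comp_smul,
      Category.comp_id]
    change (c • 𝟙 (t.total n)) ≫ t.proj h = _
    rw [Linear.smul_comp, Category.id_comp]

lemma transition_hullProj {m n : ℕ} (h : m ≤ n) (φ : t.hull) :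
    t.transition hE h (φ.1 n) = φ.1 m := by
  change End.asHom (t.exists_transition hE h (φ.1 n)).choose = End.asHom (φ.1 m)
  rw [← cancel_epi (t.proj h), (t.exists_transition hE h _).choose_spec, hull_comp_proj]

/-- A right `R^(m)`-module as a right `R^(n)`-module. -/
def raise {m n : ℕ} (h : m ≤ n) (T : t.modR m) : t.modR n where
  obj := (ModuleCat.restrictScalars
    (RingHom.op (t.transition hE h : t.R n →+* t.R m))).obj T.obj
  property := by
    have : FiniteDimensional K
      ((ModuleCat.restrictScalars (algebraMap K (t.R m)ᵐᵒᵖ)).obj T.obj) := T.property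
    let e : (ModuleCat.restrictScalars (algebraMap K (t.R m)ᵐᵒᵖ)).obj T.obj →ₗ[K]
        (ModuleCat.restrictScalars (algebraMap K (t.R n)ᵐᵒᵖ)).obj ((ModuleCat.restrictScalars
          (RingHom.op (t.transition hE h : t.R n →+* t.R m))).obj T.obj) :=
      { toFun := fun x => x
        map_add' := fun _ _ => rfl
        map_smul' := fun c x => by
          change op (algebraMap K (t.R m) c) • (show T.obj from x) =
            op (t.transition hE h (algebraMap K (t.R n) c)) • (show T.obj from x)
          rw [AlgHom.commutes] }
    exact Module.Finite.of_surjective e fun x => ⟨x, rfl⟩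

/-- Raising the level does not change the module over the hull. -/
def raiseIso {m n : ℕ} (h : m ≤ n) (T : t.modR m) :
    (t.toModNil n).obj (t.raise hE h T) ≅ (t.toModNil m).obj T :=
  let M : ModuleCat.{v} (t.hull)ᵐᵒᵖ := (t.restrict n).obj (t.raise hE h T).obj
  let N : ModuleCat.{v} (t.hull)ᵐᵒᵖ := (t.restrict m).obj T.obj
  let e : M ≃ₗ[(t.hull)ᵐᵒᵖ] N :=
    { toFun := fun x => x
      invFun := fun x => x
      left_inv := fun _ => rfl
      right_inv := fun _ => rfl
      map_add' := fun _ _ => rfl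
      map_smul' := fun φ x => by
        change op (t.transition hE h ((unop φ).1 n)) • (show T.obj from x) =
          op ((unop φ).1 m) • (show T.obj from x)
        rw [transition_hullProj] }
  ObjectProperty.isoMk _ (e.toModuleIso : M ≅ N)

include hE in
lemma exists_common_level (T U : t.modNil) : ∃ (n : ℕ) (T' U' : t.modR n),
    Nonempty ((t.toModNil n).obj T' ≅ T) ∧ Nonempty ((t.toModNil n).obj U' ≅ U) := by
  obtain ⟨n, T', ⟨e⟩⟩ := T.property
  obtain ⟨m, U', ⟨e'⟩⟩ := U.property
  refine ⟨max n m, t.raise hE (le_max_left n m) T', t.raise hE (le_max_right n m) U', ⟨?_⟩, ⟨?_⟩⟩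
  · exact t.raiseIso hE (le_max_left n m) T' ≪≫ ObjectProperty.isoMk _ e
  · exact t.raiseIso hE (le_max_right n m) U' ≪≫ ObjectProperty.isoMk _ e'

include hE in
/-- Linear maps over the hull are linear over `R^(n)`, as the hull maps onto `R^(n)`. -/
lemma bijective_toModNil_map {n : ℕ} (T U : t.modR n) :
    Function.Bijective ((t.toModNil n).map : (T ⟶ U) → _) := by
  constructor
  · intro f g h
    apply ObjectProperty.hom_ext
    ext x
    exact congrArg (fun a => a.hom.hom x) h
  · intro f
    let g : T.obj ⟶ U.obj := ModuleCat.ofHom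
      { toFun := applyRestrict f.hom
        map_add' := applyRestrict_add f.hom
        map_smul' := fun r x => by
          obtain ⟨φ, hφ⟩ := t.hullProj_surjective hE n (unop r)
          have hr : r = op (φ.1 n) := congrArg op hφ.symm
          rw [hr]
          exact applyRestrict_smul f.hom φ x }
    exact ⟨ObjectProperty.homMk g, rfl⟩

variable [HasCoproducts.{v} C] {A : ObjectProperty C}
  (hA : ∀ M, extensionClosure A E M ↔ extClosure E M)

namespace Phi

variable {t} (Φ : t.Phi A)

include hE in
lemma bijective_map (T U : t.modNil) : Function.Bijective (Φ.functor.map : (T ⟶ U) → _) := by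
  obtain ⟨n, T', U', ⟨e⟩, ⟨e'⟩⟩ := t.exists_common_level hE T U
  refine bijective_map_of_iso _ e e' ?_
  have := t.isIso_unit hE U'.property
  have h₁ : Function.Bijective
      (((finDim.{v} K (t.R n)ᵐᵒᵖ).ι ⋙ tensorFunctor (t.total n)).map : (T' ⟶ U') → _) :=
    (bijective_tensorFunctor_map T'.obj U'.obj).comp
      (Functor.FullyFaithful.map_bijective (finDim.{v} K (t.R n)ᵐᵒᵖ).fullyFaithfulι T' U')
  have h₂ : Function.Bijective
      ((t.toModNil n ⋙ Φ.functor ⋙ (extensionClosure A E).ι).map : (T' ⟶ U') → _) := by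
    have h : (((Φ.iso n).app T').homCongr ((Φ.iso n).app U')) ∘
        ((t.toModNil n ⋙ Φ.functor ⋙ (extensionClosure A E).ι).map : (T' ⟶ U') → _) =
        ((finDim.{v} K (t.R n)ᵐᵒᵖ).ι ⋙ tensorFunctor (t.total n)).map := by
      funext f
      change (Φ.iso n).inv.app T' ≫ _ ≫ (Φ.iso n).hom.app U' = _
      rw [(Φ.iso n).hom.naturality, Iso.inv_hom_id_app_assoc]
    rw [← h] at h₁
    exact (Equiv.comp_bijective _ _).1 h₁
  have h₃ : Function.Bijective ((extensionClosure A E).ι.map ∘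
      (Φ.functor.map : ((t.toModNil n).obj T' ⟶ (t.toModNil n).obj U') → _)) :=
    (Function.Bijective.of_comp_iff _ (t.bijective_toModNil_map hE T' U')).1 h₂
  exact (Function.Bijective.of_comp_iff' ((extensionClosure A E).fullyFaithfulι.map_bijective _ _)
    _).1 h₃

include hE hA in
lemma exists_iso (M : (extensionClosure A E).FullSubcategory) :
    ∃ T, Nonempty (Φ.functor.obj T ≅ M) := by
  have hM := (hA _).1 M.property
  obtain ⟨n, hn⟩ := t.exists_isStable hE hM
  have := t.isIso_counit hE hM hn
  let T : t.modR n := ⟨_, t.finDim_hom hE hM n⟩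
  exact ⟨(t.toModNil n).obj T, ⟨ObjectProperty.isoMk _
    ((Φ.iso n).app T ≪≫ asIso ((tensorAdjunction (t.total n)).counit.app M.obj))⟩⟩

include hE hA in
lemma isEquivalence : Φ.functor.IsEquivalence where
  faithful := ⟨fun h => (Φ.bijective_map hE _ _).1 h⟩
  full := ⟨fun f => (Φ.bijective_map hE _ _).2 f⟩
  essSurj := ⟨fun M => by
    obtain ⟨T, e⟩ := Φ.exists_iso hE hA M
    exact ⟨T, e⟩⟩

end Phi

end UniversalExtensionTower

/-! ### Epimorphisms of sheaves of modules are locally surjective -/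

section LocallySurjective

/-- The forgetful functor from sheaves of modules to sheaves of abelian groups preserves
epimorphisms: the sheafification of the cokernel of an epimorphism as presheaves vanishes. -/
lemma epi_toSheaf_map {D : Type*} [Category* D] {J : GrothendieckTopology D}
    {R : Sheaf J RingCat.{u}} [HasSheafify J AddCommGrpCat.{v}]
    [J.WEqualsLocallyBijective AddCommGrpCat.{v}] {M N : SheafOfModules.{v} R} (p : M ⟶ N)
    [Epi p] : Epi ((SheafOfModules.toSheaf R).map p) := by
  let adj := PresheafOfModules.sheafificationAdjunction (𝟙 R.obj)
  let a := PresheafOfModules.sheafification (𝟙 R.obj)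
  let p' := (SheafOfModules.forget R ⋙ PresheafOfModules.restrictScalars (𝟙 R.obj)).map p
  let F := PresheafOfModules.toPresheaf R.obj ⋙
    presheafToSheaf J AddCommGrpCat.{v}
  have : IsIso adj.counit :=
    inferInstanceAs (IsIso (PresheafOfModules.sheafificationAdjunction (𝟙 R.obj)).counit)
  have hadj (A : SheafOfModules.{v} R) : IsIso (adj.counit.app A) := inferInstance
  have h₁ : Epi (a.map p') := by
    have h := adj.counit.naturality p
    have h' : a.map p' = adj.counit.app M ≫ p ≫ inv (adj.counit.app N) := by
      rw [← Category.assoc, IsIso.eq_comp_inv]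
      exact h
    rw [h']
    infer_instance
  have h₂ : a.map (cokernel.π p') = 0 := by
    rw [← cancel_epi (a.map p'), ← a.map_comp, cokernel.condition, a.map_zero, comp_zero]
  have h₃ : F.map (cokernel.π p') = 0 :=
    (congrArg (SheafOfModules.toSheaf R).map h₂).trans (Functor.map_zero _ _ _)
  have h₄ : Epi (F.map p') := Preadditive.epi_of_cancel_zero _ fun {Z} f hf => by
    have hc := CokernelCofork.mapIsColimit _ (cokernelIsCokernel p') F
    obtain ⟨g, hg⟩ := CokernelCofork.IsColimit.desc' hc f hf
    have hg' : F.map (cokernel.π p') ≫ g = f := hg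
    rw [← hg', h₃]
    exact zero_comp
  have h := (sheafificationAdjunction J AddCommGrpCat.{v}).counit.naturality
    ((SheafOfModules.toSheaf R).map p)
  have h' : (SheafOfModules.toSheaf R).map p =
      inv ((sheafificationAdjunction J AddCommGrpCat.{v}).counit.app
        ((SheafOfModules.toSheaf R).obj M)) ≫ F.map p' ≫
      (sheafificationAdjunction J AddCommGrpCat.{v}).counit.app
        ((SheafOfModules.toSheaf R).obj N) := by
    rw [IsIso.eq_inv_comp]
    exact h.symm
  rw [h']
  have h₅ : Epi ((sheafificationAdjunction J AddCommGrpCat.{v}).counit.app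
      ((SheafOfModules.toSheaf R).obj N)) :=
    @IsIso.epi_of_iso _ _ _ _ _ inferInstance
  exact @epi_comp _ _ _ _ _ _ inferInstance _ (@epi_comp _ _ _ _ _ _ h₄ _ h₅)

/-- Sections lift locally along epimorphisms. -/
lemma exists_lift_section {X : Scheme.{u}} {M N : X.Modules} (p : M ⟶ N)
    [Epi p] {U : X.Opens} (s : Γ(N, U)) {x : X} (hx : x ∈ U) :
    ∃ (V : X.Opens) (h : V ≤ U) (t : Γ(M, V)), x ∈ V ∧
      p.app V t = N.presheaf.map (homOfLE h).op s := by
  have h := @epi_toSheaf_map _ _ _ X.ringCatSheaf _ _ M N p ‹_›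
  have h' := (TopCat.Sheaf.isLocallySurjective_iff_epi
    ((SheafOfModules.toSheaf X.ringCatSheaf).map p)).2 h
  obtain ⟨V, hV, ⟨t, ht⟩, hx⟩ := (TopCat.Presheaf.isLocallySurjective_iff _).1 h' U s x hx
  exact ⟨V, hV, t, hx, ht⟩

end LocallySurjective

/-! ### Local lifts of morphisms from free modules of finite rank -/

section Lift

/-- A lift of `L c` along `L p`, obtained from a lift of `c` composed with the unit. -/
lemma exists_map_lift_of_unit {A B : Type*} [Category* A] [Category* B] {L : A ⥤ B} {R : B ⥤ A}
    (adj : L ⊣ R) {P M N : A} {p : M ⟶ N} {c : P ⟶ N} (c₁ : P ⟶ R.obj (L.obj M))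
    (h : c₁ ≫ R.map (L.map p) = c ≫ adj.unit.app N) : ∃ c', c' ≫ L.map p = L.map c := by
  refine ⟨(adj.homEquiv _ _).symm c₁, ?_⟩
  rw [← Adjunction.homEquiv_naturality_right_symm, h, ← Adjunction.homEquiv_id,
    ← Adjunction.homEquiv_naturality_left, Equiv.symm_apply_apply, Category.comp_id]

/-- The free `𝒪_X`-module on a set `I`. -/
def freeModule (X : Scheme.{u}) (I : Type u) : X.Modules :=
  SheafOfModules.free (R := X.ringCatSheaf) I

/-- The global sections of `M` as compatible families of sections over all open sets. -/
abbrev compatibleSections {X : Scheme.{u}} (M : X.Modules) : Type u :=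
  SheafOfModules.sections (R := X.ringCatSheaf) M

/-- Morphisms from a free module are families of sections. -/
def freeModuleHomEquiv {X : Scheme.{u}} {I : Type u} (M : X.Modules) :
    (freeModule X I ⟶ M) ≃ (I → compatibleSections M) :=
  SheafOfModules.freeHomEquiv (R := X.ringCatSheaf) M

lemma freeModuleHomEquiv_comp {X : Scheme.{u}} {I : Type u} {M N : X.Modules}
    (c : freeModule X I ⟶ M) (p : M ⟶ N) (i : I) (U : X.Opens) :
    (freeModuleHomEquiv N (c ≫ p) i).1 (.op U) =
      p.app U (show Γ(M, U) from (freeModuleHomEquiv M c i).1 (.op U)) := rfl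

open Scheme.Modules in
/-- Finitely many sections lift along an epimorphism in a neighbourhood of any point. -/
lemma exists_lift_freeModule {X : Scheme.{u}} {I : Type u} [Finite I] {M N : X.Modules}
    (p : M ⟶ N) [Epi p] (c : freeModule X I ⟶ N) (x : X) :
    ∃ V : X.Opens, x ∈ V ∧ ∃ c', c' ≫ (restrictFunctor V.ι).map p =
      (restrictFunctor V.ι).map c := by
  have := Fintype.ofFinite I
  let s (i : I) (U : X.Opens) : Γ(N, U) := (freeModuleHomEquiv _ c i).1 (.op U)
  have hs (i : I) {U V : X.Opens} (f : U ⟶ V) : N.presheaf.map f.op (s i V) = s i U :=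
    PresheafOfModules.sections_property (freeModuleHomEquiv _ c i) f.op
  choose V hV t hxV ht using fun i => exists_lift_section p (s i ⊤) (x := x) trivial
  simp only [hs] at ht
  let W : X.Opens := Finset.univ.inf V
  have hW (i) : W ≤ V i := Finset.inf_le (Finset.mem_univ i)
  have hxW : x ∈ W := by
    rw [← SetLike.mem_coe, TopologicalSpace.Opens.coe_finset_inf]
    simpa using hxV
  refine ⟨W, hxW, ?_⟩
  have hj (i : I) (U : X.Opens) : W.ι ''ᵁ (W.ι ⁻¹ᵁ U) ≤ V i :=
    (W.ι_image_le _).trans (hW i)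
  let σ (i : I) : compatibleSections ((pushforward W.ι).obj ((restrictFunctor W.ι).obj M)) :=
    PresheafOfModules.sectionsMk (fun U => M.presheaf.map (homOfLE (hj i U.unop)).op (t i)) (by
      intro U U' f
      exact (ConcreteCategory.congr_hom (M.presheaf.map_comp _ _) (t i)).symm)
  refine exists_map_lift_of_unit (restrictAdjunction W.ι) ((freeModuleHomEquiv _).symm σ) ?_
  apply (freeModuleHomEquiv _).injective
  funext i
  apply PresheafOfModules.sections_ext
  intro U
  induction U with | op U => ?_
  rw [freeModuleHomEquiv_comp, freeModuleHomEquiv_comp, Equiv.apply_symm_apply]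
  change p.app _ (M.presheaf.map _ (t i)) =
    N.presheaf.map (homOfLE (W.ι.image_preimage_le U)).op (s i U)
  rw [hs]
  have h := ConcreteCategory.congr_hom (p.mapPresheaf.naturality (homOfLE (hj i U)).op) (t i)
  refine h.trans ?_
  change N.presheaf.map _ (p.app _ (t i)) = _
  rw [ht, hs]

end Lift

/-! ### Extensions of modules with finite presentations -/

section Horseshoe

variable {C : Type u} [Category.{v} C] [Abelian C] {S : ShortComplex C} (hS : S.ShortExact)
  {P₁ Q₁ P₃ Q₃ : C} {r₁ : P₁ ⟶ Q₁} {q₁ : Q₁ ⟶ S.X₁} {w₁ : r₁ ≫ q₁ = 0} {r₃ : P₃ ⟶ Q₃}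
  {q₃ : Q₃ ⟶ S.X₃} {w₃ : r₃ ≫ q₃ = 0} {l : Q₃ ⟶ S.X₂} {e : P₃ ⟶ Q₁}

lemma horseshoe_comp_eq_zero (w₁ : r₁ ≫ q₁ = 0) (he : e ≫ q₁ ≫ S.f = r₃ ≫ l) :
    biprod.desc (r₁ ≫ biprod.inl) (r₃ ≫ biprod.inr - e ≫ biprod.inl) ≫
      biprod.desc (q₁ ≫ S.f) l = 0 := by
  ext
  · simp [reassoc_of% w₁]
  · simp [he]

include hS in
/-- The generators of `S.X₁` and lifts of the generators of `S.X₃` generate `S.X₂`. -/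
lemma epi_horseshoe [Epi q₁] [Epi q₃] (hl : l ≫ S.g = q₃) : Epi (biprod.desc (q₁ ≫ S.f) l) := by
  have := hS.mono_f
  rw [epi_iff_surjective_up_to_refinements]
  intro A y
  obtain ⟨A₁, p₁, _, z, hz⟩ := surjective_up_to_refinements_of_epi q₃ (y ≫ S.g)
  have h : (p₁ ≫ y - z ≫ l) ≫ S.g = 0 := by simp [hz, hl]
  obtain ⟨A₂, p₂, _, x, hx⟩ := surjective_up_to_refinements_of_epi q₁ (hS.exact.lift _ h)
  refine ⟨A₂, p₂ ≫ p₁, inferInstance, biprod.lift x (p₂ ≫ z), ?_⟩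
  have hx' := hx =≫ S.f
  rw [Category.assoc, hS.exact.lift_f, Category.assoc] at hx'
  simp [← hx']

include hS in
/-- Presentations of the outer terms of a short exact sequence yield a presentation of the middle
term if the generators and the relations of the right term lift. -/
lemma exact_horseshoe (h₁ : (ShortComplex.mk r₁ q₁ w₁).Exact)
    (h₃ : (ShortComplex.mk r₃ q₃ w₃).Exact) (hl : l ≫ S.g = q₃) (he : e ≫ q₁ ≫ S.f = r₃ ≫ l) :
    (ShortComplex.mk _ _ (horseshoe_comp_eq_zero w₁ he)).Exact := by
  have := hS.mono_f
  rw [ShortComplex.exact_iff_exact_up_to_refinements]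
  intro A (y : A ⟶ Q₁ ⊞ Q₃) (hy : y ≫ biprod.desc (q₁ ≫ S.f) l = 0)
  have hy' : (y ≫ biprod.fst) ≫ q₁ ≫ S.f + (y ≫ biprod.snd) ≫ l = 0 := by
    rw [biprod.desc_eq, Preadditive.comp_add] at hy
    simpa using hy
  have hy₃ : (y ≫ biprod.snd) ≫ q₃ = 0 := by
    have h := hy' =≫ S.g
    simpa [hl] using h
  obtain ⟨A₁, p₁, _, z, hz⟩ := h₃.exact_up_to_refinements _ hy₃
  dsimp at z hz
  have h : (p₁ ≫ y ≫ biprod.fst + z ≫ e) ≫ q₁ = 0 := by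
    rw [← cancel_mono S.f]
    have h := p₁ ≫= hy'
    rw [Preadditive.comp_add, ← Category.assoc p₁ (y ≫ biprod.snd), hz, Category.assoc z, ← he] at h
    simpa using h
  obtain ⟨A₂, p₂, _, x, hx⟩ := h₁.exact_up_to_refinements _ h
  dsimp at x hx
  refine ⟨A₂, p₂ ≫ p₁, inferInstance, biprod.lift x (p₂ ≫ z), ?_⟩
  change (p₂ ≫ p₁) ≫ y = biprod.lift x (p₂ ≫ z) ≫
    biprod.desc (r₁ ≫ biprod.inl) (r₃ ≫ biprod.inr - e ≫ biprod.inl)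
  apply biprod.hom_ext
  · simp [← hx]
  · simp [← hz]

end Horseshoe

section FinitePresentation

open Scheme.Modules

variable {X Y : Scheme.{u}}

/-- Free `𝒪_X`-modules of finite rank. -/
def IsFiniteFree (P : X.Modules) : Prop :=
  ∃ (I : Type u) (_ : Finite I), Nonempty (freeModule X I ≅ P)

lemma preservesColimitsOfShape_of_restrictFunctor (f : Y ⟶ X) [IsOpenImmersion f] (J : Type*)
    [Category* J] : PreservesColimitsOfShape J (restrictFunctor f) :=
  (restrictAdjunction f).leftAdjoint_preservesColimits.preservesColimitsOfShape

lemma IsFiniteFree.restrict {P : X.Modules} (hP : IsFiniteFree P) (f : Y ⟶ X) [IsOpenImmersion f] :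
    IsFiniteFree ((restrictFunctor f).obj P) := by
  obtain ⟨I, hI, ⟨e⟩⟩ := hP
  let F : SheafOfModules X.ringCatSheaf ⥤ SheafOfModules Y.ringCatSheaf := restrictFunctor f
  have : PreservesColimitsOfShape (Discrete I) F :=
    preservesColimitsOfShape_of_restrictFunctor f (Discrete I)
  let i : freeModule Y I ≅ (restrictFunctor f).obj (freeModule X I) :=
    SheafOfModules.mapFreeIso F I (restrictUnitIso f).symm
  exact ⟨I, hI, ⟨i ≪≫ (restrictFunctor f).mapIso e⟩⟩

lemma IsFiniteFree.biprod {P Q : X.Modules} (hP : IsFiniteFree P) (hQ : IsFiniteFree Q) :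
    IsFiniteFree (P ⊞ Q) := by
  obtain ⟨I, hI, ⟨e⟩⟩ := hP
  obtain ⟨J, hJ, ⟨e'⟩⟩ := hQ
  let i : freeModule X I ⨿ freeModule X J ≅ freeModule X (I ⊕ J) :=
    SheafOfModules.freeSumIso (R := X.ringCatSheaf) I J
  exact ⟨I ⊕ J, inferInstance, ⟨i.symm ≪≫ (biprod.isoCoprod _ _).symm ≪≫ biprod.mapIso e e'⟩⟩

lemma IsFiniteFree.exists_lift {P M N : X.Modules} (hP : IsFiniteFree P) (p : M ⟶ N) [Epi p]
    (c : P ⟶ N) (x : X) : ∃ V : X.Opens, x ∈ V ∧ ∃ c', c' ≫ (restrictFunctor V.ι).map p =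
      (restrictFunctor V.ι).map c := by
  obtain ⟨I, hI, ⟨e⟩⟩ := hP
  obtain ⟨V, hx, c', hc'⟩ := exists_lift_freeModule p (e.hom ≫ c) x
  refine ⟨V, hx, (restrictFunctor V.ι).map e.inv ≫ c', ?_⟩
  rw [Category.assoc, hc', ← Functor.map_comp, Iso.inv_hom_id_assoc]

/-- `M` is a cokernel of a morphism between free modules of finite rank. -/
def HasFinitePresentation (M : X.Modules) : Prop :=
  ∃ (P Q : X.Modules) (r : P ⟶ Q) (q : Q ⟶ M) (w : r ≫ q = 0),
    IsFiniteFree P ∧ IsFiniteFree Q ∧ (ShortComplex.mk r q w).Exact ∧ Epi q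

lemma HasFinitePresentation.of_iso {M N : X.Modules} (hM : HasFinitePresentation M) (e : M ≅ N) :
    HasFinitePresentation N := by
  obtain ⟨P, Q, r, q, w, hP, hQ, h, _⟩ := hM
  refine ⟨P, Q, r, q ≫ e.hom, by rw [reassoc_of% w, zero_comp], hP, hQ, ?_, inferInstance⟩
  exact (ShortComplex.exact_iff_of_iso (S₁ := ShortComplex.mk r q w)
    (S₂ := ShortComplex.mk r (q ≫ e.hom) _)
    (ShortComplex.isoMk (Iso.refl _) (Iso.refl _) e)).1 h

instance (f : Y ⟶ X) [IsOpenImmersion f] : (restrictFunctor f).PreservesZeroMorphisms :=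
  Functor.preservesZeroMorphisms_of_isLeftAdjoint _

instance (f : Y ⟶ X) [IsOpenImmersion f] : PreservesFiniteColimits (restrictFunctor f) :=
  PreservesColimits.preservesFiniteColimits _

lemma HasFinitePresentation.restrict {M : X.Modules} (hM : HasFinitePresentation M) (f : Y ⟶ X)
    [IsOpenImmersion f] : HasFinitePresentation ((restrictFunctor f).obj M) := by
  obtain ⟨P, Q, r, q, w, hP, hQ, h, _⟩ := hM
  refine ⟨_, _, (restrictFunctor f).map r, (restrictFunctor f).map q,
    by rw [← Functor.map_comp, w, Functor.map_zero], hP.restrict f, hQ.restrict f, ?_,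
    inferInstance⟩
  exact h.map_of_epi_of_preservesCokernel (restrictFunctor f) inferInstance inferInstance

lemma hasFinitePresentation_of_isZero {M : X.Modules} (hM : IsZero M) :
    HasFinitePresentation M := by
  refine ⟨freeModule X PEmpty, freeModule X PEmpty, 𝟙 _, 0, comp_zero,
    ⟨PEmpty, inferInstance, ⟨Iso.refl _⟩⟩, ⟨PEmpty, inferInstance, ⟨Iso.refl _⟩⟩, ?_,
    ⟨fun _ _ _ => hM.eq_of_src _ _⟩⟩
  exact (ShortComplex.exact_iff_epi _ rfl).2 inferInstance

lemma mono_iff_app {M N : X.Modules} (f : M ⟶ N) : Mono f ↔ ∀ U, Mono (f.app U) := by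
  constructor
  · intro hf U
    have h : Mono ((toPresheaf X).map f) := inferInstance
    exact (NatTrans.mono_iff_mono_app _).1 h (.op U)
  · intro h
    apply (toPresheaf X).mono_of_mono_map
    exact (NatTrans.mono_iff_mono_app _).2 fun U => h U.unop

instance (f : Y ⟶ X) [IsOpenImmersion f] {M N : X.Modules} (g : M ⟶ N) [Mono g] :
    Mono ((restrictFunctor f).map g) :=
  (mono_iff_app _).2 fun U => (mono_iff_app g).1 inferInstance (f ''ᵁ U)

section

variable {M₁ M₂ M₃ : X.Modules} {f : M₁ ⟶ M₂} {g : M₂ ⟶ M₃} {w : f ≫ g = 0} (j : Y ⟶ X)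
  [IsOpenImmersion j]

lemma restrict_comp_eq_zero (w : f ≫ g = 0) :
    (restrictFunctor j).map f ≫ (restrictFunctor j).map g = 0 := by
  rw [← Functor.map_comp, w, Functor.map_zero]

lemma exact_restrict [Epi g] (h : (ShortComplex.mk f g w).Exact) :
    (ShortComplex.mk _ _ (restrict_comp_eq_zero j w)).Exact :=
  h.map_of_epi_of_preservesCokernel (restrictFunctor j) (inferInstanceAs (Epi g)) inferInstance

lemma shortExact_restrict (h : (ShortComplex.mk f g w).ShortExact) :
    (ShortComplex.mk _ _ (restrict_comp_eq_zero j w)).ShortExact := by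
  have : Mono f := h.mono_f
  have : Epi g := h.epi_g
  exact
    { exact := exact_restrict j h.exact
      mono_f := inferInstanceAs (Mono ((restrictFunctor j).map f))
      epi_g := inferInstanceAs (Epi ((restrictFunctor j).map g)) }

end

section

variable {M₁ M₂ M₃ : X.Modules} {f : M₁ ⟶ M₂} {g : M₂ ⟶ M₃} {w : f ≫ g = 0}
  (hS : (ShortComplex.mk f g w).ShortExact)

include hS

/-- If the generators of the right term of a short exact sequence lift to the middle term, then its
relations lift locally. -/
lemma exists_hasFinitePresentation_of_lift {P₃ Q₃ : X.Modules} {r₃ : P₃ ⟶ Q₃} {q₃ : Q₃ ⟶ M₃}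
    {w₃ : r₃ ≫ q₃ = 0} (h₁ : HasFinitePresentation M₁) (hP₃ : IsFiniteFree P₃)
    (hQ₃ : IsFiniteFree Q₃) (ex₃ : (ShortComplex.mk r₃ q₃ w₃).Exact) [Epi q₃] (l : Q₃ ⟶ M₂)
    (hl : l ≫ g = q₃) (x : X) :
    ∃ V : X.Opens, x ∈ V ∧ HasFinitePresentation ((restrictFunctor V.ι).obj M₂) := by
  obtain ⟨P₁, Q₁, r₁, q₁, w₁, hP₁, hQ₁, ex₁, _⟩ := h₁
  have : Mono f := hS.mono_f
  have h0 : (r₃ ≫ l) ≫ g = 0 := by rw [Category.assoc, hl, w₃]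
  obtain ⟨V, hx, e, he⟩ := hP₃.exists_lift q₁ (hS.exact.lift _ h0) x
  let F := restrictFunctor V.ι
  have hl' : F.map l ≫ F.map g = F.map q₃ := by rw [← F.map_comp, hl]
  have he' : e ≫ F.map q₁ ≫ F.map f = F.map r₃ ≫ F.map l := by
    rw [← Category.assoc, he, ← F.map_comp, ← F.map_comp]
    exact congrArg _ (hS.exact.lift_f _ h0)
  have : Epi (F.map q₁) := inferInstance
  have : Epi (F.map q₃) := inferInstance
  exact ⟨V, hx, _, _, _, _, _, (hP₁.restrict _).biprod (hP₃.restrict _),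
      (hQ₁.restrict _).biprod (hQ₃.restrict _),
      exact_horseshoe (shortExact_restrict V.ι hS) (exact_restrict V.ι ex₁)
        (exact_restrict V.ι ex₃) hl' he',
      epi_horseshoe (shortExact_restrict V.ι hS) hl'⟩

/-- In the neighbourhood of any point, an extension of modules with finite presentations has a
finite presentation. -/
lemma exists_hasFinitePresentation_of_shortExact
    (h₁ : HasFinitePresentation M₁) (h₃ : HasFinitePresentation M₃) (x : X) :
    ∃ (Z : Scheme.{u}) (j : Z ⟶ X) (_ : IsOpenImmersion j), x ∈ j.opensRange ∧
      HasFinitePresentation ((restrictFunctor j).obj M₂) := by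
  obtain ⟨P₃, Q₃, r₃, q₃, w₃, hP₃, hQ₃, ex₃, _⟩ := h₃
  have : Epi g := hS.epi_g
  obtain ⟨V, hxV, l, hl⟩ := hQ₃.exists_lift g q₃ x
  obtain ⟨W, hxW, h⟩ := exists_hasFinitePresentation_of_lift (shortExact_restrict V.ι hS)
    (h₁.restrict V.ι) (hP₃.restrict V.ι) (hQ₃.restrict V.ι) (exact_restrict V.ι ex₃) l hl ⟨x, hxV⟩
  exact ⟨W, W.ι ≫ V.ι, inferInstance, ⟨⟨⟨x, hxV⟩, hxW⟩, rfl⟩,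
    h.of_iso ((restrictFunctorComp W.ι V.ι).app M₂).symm⟩

end

end FinitePresentation

/-! ### Sheaves of modules of finite presentation -/

section Coherent

open Scheme.Modules

lemma exists_exact_of_presentation {D : Type*} [Category* D] {J : GrothendieckTopology D}
    {R : Sheaf J RingCat.{u}} [HasSheafify J AddCommGrpCat.{u}]
    [J.WEqualsLocallyBijective AddCommGrpCat.{u}] {M : SheafOfModules.{u} R} (p : M.Presentation) :
    ∃ (r : SheafOfModules.free p.relations.I ⟶ SheafOfModules.free p.generators.I)
      (w : r ≫ p.generators.π = 0), (ShortComplex.mk r p.generators.π w).Exact :=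
  have w : ((SheafOfModules.freeHomEquiv _).symm p.relations.s ≫ kernel.ι p.generators.π) ≫
      p.generators.π = 0 := by rw [Category.assoc, kernel.condition, comp_zero]
  ⟨_, w, (ShortComplex.mk _ _ w).exact_of_g_is_cokernel p.isColimit⟩

variable {X Y : Scheme.{u}}

/-- Finite presentations in the sense of `HasFinitePresentation` as presentations by finitely many
generators and relations. -/
lemma HasFinitePresentation.exists_presentation {M : X.Modules} (hM : HasFinitePresentation M) :
    ∃ p : SheafOfModules.Presentation (R := X.ringCatSheaf) M, p.IsFinite := by
  obtain ⟨P, Q, r, q, w, ⟨I, hI, ⟨e⟩⟩, ⟨J, hJ, ⟨e'⟩⟩, h, _⟩ := hM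
  let r' : freeModule X I ⟶ freeModule X J := e.hom ≫ r ≫ e'.inv
  let q' : freeModule X J ⟶ M := e'.hom ≫ q
  have w' : r' ≫ q' = 0 := by simp [r', q', w]
  have h' : (ShortComplex.mk r' q' w').Exact :=
    (ShortComplex.exact_iff_of_iso (S₁ := ShortComplex.mk r q w) (S₂ := ShortComplex.mk r' q' w')
      (ShortComplex.isoMk e.symm e'.symm (Iso.refl _) (by simp [r']) (by simp [q']))).1 h
  have : Epi q' := inferInstance
  let c : IsColimit (CokernelCofork.ofπ q' w') := h'.gIsCokernel
  exact ⟨SheafOfModules.presentationOfIsCokernelFree (R := X.ringCatSheaf) r' q' w' c,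
    ⟨⟨hJ⟩, ⟨hI⟩⟩⟩

lemma hasFinitePresentation_of_presentation {M : X.Modules}
    (p : SheafOfModules.Presentation (R := X.ringCatSheaf) M) (hp : p.IsFinite) :
    HasFinitePresentation M := by
  have h₁ := hp.isFiniteType_generators.finite
  have h₂ := hp.isFiniteType_relations.finite
  obtain ⟨r, w, h⟩ := exists_exact_of_presentation p
  exact ⟨freeModule X p.relations.I, freeModule X p.generators.I, r, p.generators.π, w,
    ⟨_, h₂, ⟨Iso.refl _⟩⟩, ⟨_, h₁, ⟨Iso.refl _⟩⟩, h, p.generators.epi⟩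

/-- Modules on the open subscheme `U` are the same as modules on the slice site over `U`, which
Mathlib uses for local presentations. -/
lemma HasFinitePresentation.exists_presentation_over {M : X.Modules} {U : X.Opens}
    (h : HasFinitePresentation ((restrictFunctor U.ι).obj M)) :
    ∃ p : (SheafOfModules.over (R := X.ringCatSheaf) M U).Presentation, p.IsFinite := by
  obtain ⟨p, hp⟩ := h.exists_presentation
  have h₁ := hp.isFiniteType_generators.finite
  have h₂ := hp.isFiniteType_relations.finite
  let G : SheafOfModules U.toScheme.ringCatSheaf ⥤ SheafOfModules (X.ringCatSheaf.over U) :=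
    (overEquiv U).inverse
  have : G.IsEquivalence := inferInstanceAs (overEquiv U).inverse.IsEquivalence
  let p' := p.map G (U.sheafOfModulesEquivOverInverseUnit X.ringCatSheaf).symm
  let e : G.obj ((restrictFunctor U.ι).obj M) ≅ SheafOfModules.over (R := X.ringCatSheaf) M U :=
    (overEquiv U).inverse.mapIso ((overFunctorEquiv U).app M).symm ≪≫
      ((overEquiv U).unitIso.app _).symm
  exact ⟨p'.ofIsIso e.hom,
    ⟨⟨show Finite p.generators.I from h₁⟩, ⟨show Finite p.relations.I from h₂⟩⟩⟩

lemma hasFinitePresentation_of_presentation_over {M : X.Modules} {U : X.Opens}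
    (p : (SheafOfModules.over (R := X.ringCatSheaf) M U).Presentation) (hp : p.IsFinite) :
    HasFinitePresentation ((restrictFunctor U.ι).obj M) := by
  have h₁ := hp.isFiniteType_generators.finite
  have h₂ := hp.isFiniteType_relations.finite
  let F : SheafOfModules (X.ringCatSheaf.over U) ⥤ SheafOfModules U.toScheme.ringCatSheaf :=
    (overEquiv U).functor
  have : F.IsEquivalence := inferInstanceAs (overEquiv U).functor.IsEquivalence
  let p' := p.map F (U.sheafOfModulesEquivOverUnit X.ringCatSheaf).symm
  refine HasFinitePresentation.of_iso ?_ ((overFunctorEquiv U).app M)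
  exact hasFinitePresentation_of_presentation p'
    ⟨⟨show Finite p.generators.I from h₁⟩, ⟨show Finite p.relations.I from h₂⟩⟩

/-- Finite presentation as the existence of finite presentations on neighbourhoods of all points. -/
lemma isFinitePresentation_iff (M : X.Modules) :
    SheafOfModules.IsFinitePresentation (R := X.ringCatSheaf) M ↔
      ∀ x : X, ∃ U : X.Opens, x ∈ U ∧ HasFinitePresentation ((restrictFunctor U.ι).obj M) := by
  constructor
  · rintro ⟨σ, hσ⟩ x
    have hc := σ.coversTop
    rw [Opens.coversTop_iff] at hc
    have hx : x ∈ ⨆ i, σ.X i := by rw [hc]; trivial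
    obtain ⟨i, hi⟩ := TopologicalSpace.Opens.mem_iSup.1 hx
    exact ⟨σ.X i, hi, hasFinitePresentation_of_presentation_over _ (hσ.isFinite_presentation i)⟩
  · intro h
    choose U hU hfp using h
    choose p hp using fun x => (hfp x).exists_presentation_over
    let σ : SheafOfModules.QuasicoherentData.{u} (R := X.ringCatSheaf) M :=
      { I := X
        X := U
        coversTop := by
          rw [Opens.coversTop_iff]
          exact top_unique fun x _ => TopologicalSpace.Opens.mem_iSup.2 ⟨x, hU x⟩
        presentation := p }
    have hσ : σ.IsFinitePresentation := by
      constructor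
      exact hp
    constructor
    exact ⟨σ, hσ⟩

lemma HasFinitePresentation.restrict_of_le {M : X.Modules} {U V : X.Opens} (h : V ≤ U)
    (hM : HasFinitePresentation ((restrictFunctor U.ι).obj M)) :
    HasFinitePresentation ((restrictFunctor V.ι).obj M) :=
  (hM.restrict (X.homOfLE h)).of_iso <| (restrictFunctorComp (X.homOfLE h) U.ι).symm.app M ≪≫
    (restrictFunctorCongr (X.homOfLE_ι h)).app M

/-- Sheaves of modules of finite presentation are closed under extensions. -/
lemma isFinitePresentation_of_shortExact {M₁ M₂ M₃ : X.Modules} {f : M₁ ⟶ M₂} {g : M₂ ⟶ M₃}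
    {w : f ≫ g = 0} (hS : (ShortComplex.mk f g w).ShortExact)
    (h₁ : SheafOfModules.IsFinitePresentation (R := X.ringCatSheaf) M₁)
    (h₃ : SheafOfModules.IsFinitePresentation (R := X.ringCatSheaf) M₃) :
    SheafOfModules.IsFinitePresentation (R := X.ringCatSheaf) M₂ := by
  rw [isFinitePresentation_iff] at h₁ h₃ ⊢
  intro x
  obtain ⟨U₁, hx₁, hU₁⟩ := h₁ x
  obtain ⟨U₃, hx₃, hU₃⟩ := h₃ x
  let U := U₁ ⊓ U₃
  have hx : x ∈ U := ⟨hx₁, hx₃⟩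
  obtain ⟨Z, j, _, hxj, hj⟩ := exists_hasFinitePresentation_of_shortExact
    (shortExact_restrict U.ι hS) (hU₁.restrict_of_le inf_le_left)
    (hU₃.restrict_of_le inf_le_right) ⟨x, hx⟩
  let V := (j ≫ U.ι).opensRange
  have hV := (hj.of_iso ((restrictFunctorComp j U.ι).symm.app M₂)).restrict
    (j ≫ U.ι).isoOpensRange.inv
  obtain ⟨z, hz⟩ := hxj
  refine ⟨V, ⟨z, ?_⟩, hV.of_iso ((restrictFunctorComp _ _).symm.app M₂ ≪≫
    (restrictFunctorCongr (Scheme.Hom.isoOpensRange_inv_comp _)).app M₂)⟩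
  exact congrArg U.ι hz

lemma isFinitePresentation_of_isZero {M : X.Modules} (hM : IsZero M) :
    SheafOfModules.IsFinitePresentation (R := X.ringCatSheaf) M :=
  (isFinitePresentation_iff M).2 fun _ =>
    ⟨⊤, trivial, (hasFinitePresentation_of_isZero hM).restrict _⟩

end Coherent

/-! ### Coherent sheaves -/

instance (X : Scheme.{0}) : (isCoherent X).IsClosedUnderExtensions where
  prop_X₂_of_shortExact {S} hS h₁ h₃ :=
    isFinitePresentation_of_shortExact (f := S.f) (g := S.g) (w := S.zero) hS h₁ h₃

end NCHull

end

theorem proposition5p7 (X : Scheme.{0}) [X.Over NCHull.SpecC]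
    (hX : NCHull.IsSmoothProjectiveVariety X) {k : ℕ} (E : Fin k → X.Modules)
    (hcoh : ∀ i, NCHull.isCoherent X (E i)) (hE : NCHull.IsSimpleCollection ℂ E)
    (t : NCHull.UniversalExtensionTower.{1} ℂ E) :
    Nonempty (t.Phi (NCHull.isCoherent X)) ∧
      ∀ Φ : t.Phi (NCHull.isCoherent X), Φ.functor.IsEquivalence := by
  have hA := NCHull.extensionClosure_iff (NCHull.isCoherent X)
    (fun _ hM => NCHull.isFinitePresentation_of_isZero hM) hcoh
  exact ⟨⟨t.phi hE hA⟩, fun Φ => Φ.isEquivalence hE hA⟩
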